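/- Let $\overline{\mathbb Q}$ be the algebraic closure of $\mathbb Q$ in $\mathbb C$. For a subfield $L\subseteq\overline{\mathbb Q}$, an $L$-de Rham–Betti object (over $\overline{\mathbb Q}$) is a triple $N=(N_{\mathrm{dR}},N_{\mathrm B},c_N)$ consisting of a finite-dimensional $\overline{\mathbb Q}$-vector space $N_{\mathrm{dR}}$, a finite-dimensional $L$-vector space $N_{\mathrm B}$ and a $\mathbb C$-linear isomorphism $c_N\colon N_{\mathrm{dR}}\otimes_{\overline{\mathbb Q}}\mathbb C\to N_{\mathrm B}\otimes_L\mathbb C$; a morphism is a pair of linear maps $(f_{\mathrm{dR}},f_{\mathrm B})$ compatible with the comparison isomorphisms. For $L=\mathbb Q$ one speaks of de Rham–Betti objects. With the componentwise tensor products, duals, direct sums and unit object, the $\overline{\mathbb Q}$-de Rham–Betti objects form a neutral Tannakian category over $\overline{\mathbb Q}$ with the two fibre functors $\omega_{\mathrm{dR}}\colon N\mapsto N_{\mathrm{dR}}$ and $\omega_{\mathrm B}\colon N\mapsto N_{\mathrm B}$. For such an $N$, let $\langle N\rangle$ be the full subcategory of subquotients of the tensor spaces $\bigoplus_{\mathrm{finite}}N^{\otimes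 n_i}\otimes(N^\vee)^{\otimes m_i}$, and let $$\Omega_N^{\overline{\mathbb Q}\text{-}\mathrm{dRB}}=\operatorname{Iso}^{\otimes}\bigl(\omega_{\mathrm{dR}}|_{\langle N\rangle},\omega_{\mathrm B}|_{\langle N\rangle}\bigr)$$ be its Tannakian torsor of periods, whose points with values in a commutative $\overline{\mathbb Q}$-algebra $R$ are the natural families of $R$-linear isomorphisms $X_{\mathrm{dR}}\otimes R\to X_{\mathrm B}\otimes R$, $X\in\langle N\rangle$, compatible with tensor products and the unit object. For finite-dimensional $\overline{\mathbb Q}$-vector spaces $V,W$, a $\overline{\mathbb Q}$-subtorsor of the $\overline{\mathbb Q}$-scheme $\operatorname{Iso}_{\overline{\mathbb Q}}(V,W)$ is a closed subscheme which is a torsor under a closed $\overline{\mathbb Q}$-subgroup of $\mathrm{GL}(W)$ acting by composition. 1. Let $N$ be a $\overline{\mathbb Q}$-de Rham–Betti object. Evaluation at $N$ is injective on $R$-valued points for every commutative $\overline{\mathbb Q}$-algebra $R$, and its image, that is, $\Omega_N^{\overline{\mathbb Q}\text{-}\mathrm{dRB}}$ viewed inside $\operatorname{Iso}_{\overline{\mathbb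 Q}}(N_{\mathrm{dR}},N_{\mathrm B})$, is equal to $\Omega_N$, the smallest $\overline{\mathbb Q}$-subtorsor of $\operatorname{Iso}_{\overline{\mathbb Q}}(N_{\mathrm{dR}},N_{\mathrm B})$ containing the complex point $c_N$: $$\Omega_N=\Omega_N^{\overline{\mathbb Q}\text{-}\mathrm{dRB}}.$$ 2. In particular, let $M$ be a de Rham–Betti object, let $M\otimes\overline{\mathbb Q}=(M_{\mathrm{dR}},M_{\mathrm B}\otimes_{\mathbb Q}\overline{\mathbb Q},c_M)$, and let $\Omega_M$ be the smallest $\overline{\mathbb Q}$-subtorsor of $\operatorname{Iso}_{\overline{\mathbb Q}}(M_{\mathrm{dR}},M_{\mathrm B}\otimes_{\mathbb Q}\overline{\mathbb Q})$ containing the complex point $c_M$. Then $$\Omega_M=\Omega_{M\otimes\overline{\mathbb Q}}^{\overline{\mathbb Q}\text{-}\mathrm{dRB}}.$$ -/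

import Mathlib

open scoped TensorProduct
open CategoryTheory

noncomputable section

/-! ### Isomorphisms of vector spaces over two fields, after extension of scalars -/

namespace DRB

/-- For a vector space `V` over `K`, a vector space `W` over `L` and a commutative ring `R` which is
an algebra over `K` and over `L`: the `R`-linear isomorphisms from `V ⊗ R` to `W ⊗ R`. With `K = L = k`, these
are the `R`-valued points of the `k`-scheme `Iso(V, W)`. -/
abbrev IsoPt (K L V W R : Type) [Field K] [Field L] [AddCommGroup V] [Module K V]
    [AddCommGroup W] [Module L W] [CommRing R] [Algebra K R] [Algebra L R] : Type :=
  (R ⊗[K] V) ≃ₗ[R] (R ⊗[L] W)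

namespace IsoPt

section TwoFields

variable {K L V W V₁ W₁ V₂ W₂ R : Type} [Field K] [Field L]
  [AddCommGroup V] [Module K V] [AddCommGroup W] [Module L W]
  [AddCommGroup V₁] [Module K V₁] [AddCommGroup W₁] [Module L W₁]
  [AddCommGroup V₂] [Module K V₂] [AddCommGroup W₂] [Module L W₂]
  [CommRing R] [Algebra K R] [Algebra L R]

/-- The canonical isomorphism `K ⊗ R ≃ R ≃ L ⊗ R`. -/
def unit (K L R : Type) [Field K] [Field L] [CommRing R] [Algebra K R] [Algebra L R] :
    IsoPt K L K L R :=
  TensorProduct.AlgebraTensorModule.rid K R R ≪≫ₗ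
    (TensorProduct.AlgebraTensorModule.rid L R R).symm

/-- The unique isomorphism between the zero spaces. -/
def zero (K L R : Type) [Field K] [Field L] [CommRing R] [Algebra K R] [Algebra L R] :
    IsoPt K L PUnit PUnit R where
  toFun _ := 0
  invFun _ := 0
  map_add' _ _ := by simp
  map_smul' _ _ := by simp
  left_inv _ := Subsingleton.elim _ _
  right_inv _ := Subsingleton.elim _ _

/-- The tensor product of two isomorphisms, through
`(V₁ ⊗ V₂) ⊗ R ≃ (V₁ ⊗ R) ⊗ (V₂ ⊗ R)`, the middle tensor product being over `R`. -/
def tensor (f : IsoPt K L V₁ W₁ R) (g : IsoPt K L V₂ W₂ R) :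
    IsoPt K L (V₁ ⊗[K] V₂) (W₁ ⊗[L] W₂) R :=
  TensorProduct.AlgebraTensorModule.distribBaseChange K R V₁ V₂ ≪≫ₗ
    TensorProduct.congr f g ≪≫ₗ
    (TensorProduct.AlgebraTensorModule.distribBaseChange L R W₁ W₂).symm

/-- The direct sum of two isomorphisms. -/
def prod (f : IsoPt K L V₁ W₁ R) (g : IsoPt K L V₂ W₂ R) :
    IsoPt K L (V₁ × V₂) (W₁ × W₂) R :=
  TensorProduct.prodRight K R R V₁ V₂ ≪≫ₗ
    LinearEquiv.prodCongr f g ≪≫ₗ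
    (TensorProduct.prodRight L R R W₁ W₂).symm

/-- The contragredient of an isomorphism: the inverse of its transpose, through
`V^∨ ⊗ R ≃ Hom_R(V ⊗ R, R)`. -/
def dual [FiniteDimensional K V] [FiniteDimensional L W] (f : IsoPt K L V W R) :
    IsoPt K L (Module.Dual K V) (Module.Dual L W) R :=
  (TensorProduct.isBaseChange K V R).toDualBaseChange ≪≫ₗ
    f.symm.dualMap ≪≫ₗ
    (TensorProduct.isBaseChange L W R).toDualBaseChange.symm

end TwoFields

section OneField

variable {k V W U R S : Type} [Field k]
  [AddCommGroup V] [Module k V] [AddCommGroup W] [Module k W] [AddCommGroup U] [Module k U]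
  [CommRing R] [Algebra k R] [CommRing S] [Algebra k S]

/-- The base change `V ⊗ S → W ⊗ S` of an `R`-linear map `f : V ⊗ R → W ⊗ R` along `φ : R → S`:
the `S`-linear map with `v ⊗ 1 ↦ (id ⊗ φ) (f (v ⊗ 1))`. -/
def mapHom (φ : R →ₐ[k] S) (f : R ⊗[k] V →ₗ[R] R ⊗[k] W) : S ⊗[k] V →ₗ[S] S ⊗[k] W :=
  LinearMap.liftBaseChange S
    ((φ.toLinearMap.rTensor W) ∘ₗ (f.restrictScalars k) ∘ₗ (TensorProduct.mk k R V 1))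

theorem mapHom_tmul (φ : R →ₐ[k] S) (f : R ⊗[k] V →ₗ[R] R ⊗[k] W) (s : S) (v : V) :
    mapHom φ f (s ⊗ₜ v) = s • (φ.toLinearMap.rTensor W) (f (1 ⊗ₜ v)) := rfl

theorem mapHom_rTensor (φ : R →ₐ[k] S) (f : R ⊗[k] V →ₗ[R] R ⊗[k] W) (x : R ⊗[k] V) :
    mapHom φ f (φ.toLinearMap.rTensor V x) = φ.toLinearMap.rTensor W (f x) := by
  have key : ∀ (r : R) (y : R ⊗[k] W),
      φ.toLinearMap.rTensor W (r • y) = φ r • φ.toLinearMap.rTensor W y := by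
    intro r y
    induction y with
    | zero => simp
    | add a b ha hb => simp only [smul_add, map_add, ha, hb]
    | tmul a b => simp [TensorProduct.smul_tmul']
  induction x with
  | zero => simp
  | add a b ha hb => simp only [map_add, ha, hb]
  | tmul a b =>
    rw [LinearMap.rTensor_tmul, mapHom_tmul]
    have h : a ⊗ₜ[k] b = a • ((1 : R) ⊗ₜ[k] b) := by simp [TensorProduct.smul_tmul']
    rw [h, map_smul, key]
    rfl

theorem mapHom_comp (φ : R →ₐ[k] S) (g : R ⊗[k] W →ₗ[R] R ⊗[k] U)
    (f : R ⊗[k] V →ₗ[R] R ⊗[k] W) :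
    mapHom φ (g ∘ₗ f) = mapHom φ g ∘ₗ mapHom φ f := by
  ext v
  simp [mapHom_tmul, mapHom_rTensor]

theorem mapHom_id (φ : R →ₐ[k] S) :
    mapHom φ (LinearMap.id : R ⊗[k] V →ₗ[R] R ⊗[k] V) = LinearMap.id := by
  ext v
  simp [mapHom_tmul]

/-- The map `Iso(V, W)(R) → Iso(V, W)(S)` induced by `φ : R → S`. -/
def map (φ : R →ₐ[k] S) (f : IsoPt k k V W R) : IsoPt k k V W S :=
  LinearEquiv.ofLinearMap (mapHom φ f.toLinearMap) (mapHom φ f.symm.toLinearMap)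
    (by rw [← mapHom_comp, LinearEquiv.comp_symm, mapHom_id])
    (by rw [← mapHom_comp, LinearEquiv.symm_comp, mapHom_id])

end OneField

end IsoPt

/-! ### Closed subschemes and subtorsors of `Iso(V, W)` -/

section Torsor

variable (k V W : Type) [Field k] [AddCommGroup V] [Module k V] [AddCommGroup W] [Module k W]

/-- A regular function on the affine `k`-scheme `Iso(V, W)`: a morphism to the affine line, given
on `R`-valued points, naturally in the commutative `k`-algebra `R`. -/
structure RegularFunction where
  toFun : ∀ (R : Type) [CommRing R] [Algebra k R], IsoPt k k V W R → R
  natural : ∀ (R S : Type) [CommRing R] [Algebra k R] [CommRing S] [Algebra k S]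
    (φ : R →ₐ[k] S) (f : IsoPt k k V W R), toFun S (f.map φ) = φ (toFun R f)

/-- A family of subsets of the sets `Iso(V, W)(R)`, for all commutative `k`-algebras `R`,
ordered by inclusion. -/
def PointFamily : Type 1 :=
  ∀ (R : Type) [CommRing R] [Algebra k R], Set (IsoPt k k V W R)

variable {k V W}

instance : PartialOrder (PointFamily k V W) where
  le T T' := ∀ (R : Type) [CommRing R] [Algebra k R], T R ⊆ T' R
  le_refl _ _ _ _ := subset_rfl
  le_trans _ _ _ h h' R _ _ := (h R).trans (h' R)
  le_antisymm _ _ h h' := by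
    funext R _ _
    exact (h R).antisymm (h' R)

/-- The family is the functor of points of a closed subscheme of `Iso(V, W)`: it is the vanishing
locus of a set of regular functions. -/
def PointFamily.IsClosedSubscheme (T : PointFamily k V W) : Prop :=
  ∃ I : Set (RegularFunction k V W), ∀ (R : Type) [CommRing R] [Algebra k R]
    (f : IsoPt k k V W R), f ∈ T R ↔ ∀ φ ∈ I, φ.toFun R f = 0

/-- The family is the functor of points of a closed `k`-subgroup of `GL(W) = Iso(W, W)`. -/
structure IsClosedSubgroup (G : PointFamily k W W) : Prop where
  closed : G.IsClosedSubscheme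
  one_mem : ∀ (R : Type) [CommRing R] [Algebra k R], (1 : IsoPt k k W W R) ∈ G R
  mul_mem : ∀ (R : Type) [CommRing R] [Algebra k R] (g h : IsoPt k k W W R),
    g ∈ G R → h ∈ G R → g * h ∈ G R
  inv_mem : ∀ (R : Type) [CommRing R] [Algebra k R] (g : IsoPt k k W W R),
    g ∈ G R → g⁻¹ ∈ G R

/-- `T` is a torsor under `G ⊆ GL(W)`, acting by composition: `T` is stable under `G`, any two
`R`-valued points of `T` differ by an `R`-valued point of `G` (so that `G × T ≃ T × T`), and `T`
is not the empty scheme. As `T` is of finite type over the field `k`, the last condition says that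
`T → Spec k` is faithfully flat of finite presentation. -/
structure IsTorsorUnder (G : PointFamily k W W) (T : PointFamily k V W) : Prop where
  smul_mem : ∀ (R : Type) [CommRing R] [Algebra k R] (g : IsoPt k k W W R)
    (t : IsoPt k k V W R), g ∈ G R → t ∈ T R → t ≪≫ₗ g ∈ T R
  div_mem : ∀ (R : Type) [CommRing R] [Algebra k R] (t t' : IsoPt k k V W R),
    t ∈ T R → t' ∈ T R → t.symm ≪≫ₗ t' ∈ G R
  nonempty : ∃ (R : Type) (_ : CommRing R) (_ : Algebra k R), Nontrivial R ∧ (T R).Nonempty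

/-- `T` is a `k`-subtorsor of `Iso(V, W)`: a closed subscheme which is a torsor under a closed
`k`-subgroup of `GL(W)`. -/
def IsSubtorsor (T : PointFamily k V W) : Prop :=
  T.IsClosedSubscheme ∧ ∃ G : PointFamily k W W, IsClosedSubgroup G ∧ IsTorsorUnder G T

/-- `T` is the smallest `k`-subtorsor of `Iso(V, W)` containing the `R`-valued point `c`. -/
def IsSmallestSubtorsorContaining {R : Type} [CommRing R] [Algebra k R]
    (c : IsoPt k k V W R) (T : PointFamily k V W) : Prop :=
  IsLeast {T' : PointFamily k V W | IsSubtorsor T' ∧ c ∈ T' R} T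

end Torsor

/-! ### De Rham–Betti objects -/

/-- An `L`-de Rham–Betti object over `K`, where `K` and `L` are embedded in `ℂ`: a
finite-dimensional `K`-vector space, a finite-dimensional `L`-vector space and a comparison
isomorphism between their complexifications. -/
structure Obj (K L : Type) [Field K] [Field L] [Algebra K ℂ] [Algebra L ℂ] : Type 1 where
  /-- the de Rham space -/
  dR : Type
  /-- the Betti space -/
  B : Type
  [addCommGroup_dR : AddCommGroup dR]
  [module_dR : Module K dR]
  [finite_dR : FiniteDimensional K dR]
  [addCommGroup_B : AddCommGroup B]
  [module_B : Module L B]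
  [finite_B : FiniteDimensional L B]
  /-- the comparison isomorphism -/
  c : IsoPt K L dR B ℂ

attribute [instance] Obj.addCommGroup_dR Obj.module_dR Obj.finite_dR
  Obj.addCommGroup_B Obj.module_B Obj.finite_B

section Category

variable {K L : Type} [Field K] [Field L] [Algebra K ℂ] [Algebra L ℂ]

/-- A de Rham–Betti homomorphism: a pair of linear maps compatible with the comparisons. -/
@[ext]
structure Hom (X Y : Obj K L) : Type where
  dR : X.dR →ₗ[K] Y.dR
  B : X.B →ₗ[L] Y.B
  comm : Y.c.toLinearMap ∘ₗ dR.baseChange ℂ = B.baseChange ℂ ∘ₗ X.c.toLinearMap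

instance : Category (Obj K L) where
  Hom := Hom
  id X := ⟨LinearMap.id, LinearMap.id, by simp⟩
  comp f g := ⟨g.dR ∘ₗ f.dR, g.B ∘ₗ f.B, by
    rw [LinearMap.baseChange_comp, LinearMap.baseChange_comp, ← LinearMap.comp_assoc, g.comm,
      LinearMap.comp_assoc, f.comm, LinearMap.comp_assoc]⟩

namespace Obj

/-- The unit object. -/
abbrev unit (K L : Type) [Field K] [Field L] [Algebra K ℂ] [Algebra L ℂ] : Obj K L :=
  ⟨K, L, IsoPt.unit K L ℂ⟩

/-- The zero object. -/
abbrev zero (K L : Type) [Field K] [Field L] [Algebra K ℂ] [Algebra L ℂ] : Obj K L :=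
  ⟨PUnit, PUnit, IsoPt.zero K L ℂ⟩

/-- The tensor product of two objects. -/
abbrev tensor (X Y : Obj K L) : Obj K L :=
  ⟨X.dR ⊗[K] Y.dR, X.B ⊗[L] Y.B, X.c.tensor Y.c⟩

/-- The direct sum of two objects. -/
abbrev prod (X Y : Obj K L) : Obj K L :=
  ⟨X.dR × Y.dR, X.B × Y.B, X.c.prod Y.c⟩

/-- The dual of an object. -/
abbrev dual (X : Obj K L) : Obj K L :=
  ⟨Module.Dual K X.dR, Module.Dual L X.B, X.c.dual⟩

/-- The tensor power `X ^ ⊗ n`. -/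
def tensorPow (X : Obj K L) : ℕ → Obj K L
  | 0 => unit K L
  | n + 1 => (X.tensorPow n).tensor X

/-- The finite direct sum of the objects `X ^ ⊗ n ⊗ (X^∨) ^ ⊗ m`, over the pairs `(n, m)` in a
list. -/
def tensorSpace (X : Obj K L) : List (ℕ × ℕ) → Obj K L
  | [] => zero K L
  | p :: l => ((X.tensorPow p.1).tensor (X.dual.tensorPow p.2)).prod (X.tensorSpace l)

/-- `X` is a subquotient of `Y`, that is, a quotient of a subobject of `Y`. Kernels and cokernels
are those of the underlying linear maps, so that the monomorphisms (epimorphisms) are the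
injective (surjective) homomorphisms. -/
def IsSubquotient (X Y : Obj K L) : Prop :=
  ∃ (S : Obj K L) (i : S ⟶ Y) (p : S ⟶ X),
    (Function.Injective i.dR ∧ Function.Injective i.B) ∧
    (Function.Surjective p.dR ∧ Function.Surjective p.B)

/-- `N.gen X` means that `X` belongs to the Tannakian subcategory `⟨N⟩` generated by `N`, the full
subcategory of the subquotients of the tensor spaces of `N`. -/
def gen (N : Obj K L) : ObjectProperty (Obj K L) :=
  fun X => ∃ l : List (ℕ × ℕ), X.IsSubquotient (N.tensorSpace l)

/-- The object `N` belongs to `⟨N⟩`. -/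
theorem gen_self (N : Obj K L) : N.gen N := by
  refine ⟨[(1, 0)], N, ⟨?_, ?_, ?_⟩, 𝟙 N, ?_, Function.surjective_id, Function.surjective_id⟩
  · exact LinearMap.inl K ((K ⊗[K] N.dR) ⊗[K] K) PUnit ∘ₗ
      ((TensorProduct.lid K N.dR).symm ≪≫ₗ
        (TensorProduct.rid K (K ⊗[K] N.dR)).symm).toLinearMap
  · exact LinearMap.inl L ((L ⊗[L] N.B) ⊗[L] L) PUnit ∘ₗ
      ((TensorProduct.lid L N.B).symm ≪≫ₗ
        (TensorProduct.rid L (L ⊗[L] N.B)).symm).toLinearMap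
  · ext n
    change (((IsoPt.unit K L ℂ).tensor N.c).tensor (IsoPt.unit K L ℂ)).prod (IsoPt.zero K L ℂ)
      (1 ⊗ₜ (((1 : K) ⊗ₜ n) ⊗ₜ (1 : K), 0)) = LinearMap.baseChange ℂ
        (LinearMap.inl L ((L ⊗[L] N.B) ⊗[L] L) PUnit ∘ₗ
          ((TensorProduct.lid L N.B).symm ≪≫ₗ
            (TensorProduct.rid L (L ⊗[L] N.B)).symm).toLinearMap) (N.c (1 ⊗ₜ n))
    simp only [IsoPt.prod, IsoPt.tensor, IsoPt.unit, LinearEquiv.trans_apply]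
    generalize hz : N.c (1 ⊗ₜ n) = z
    rw [LinearEquiv.symm_apply_eq]
    refine Prod.ext ?_ (Subsingleton.elim _ _)
    simp only [TensorProduct.prodRight_tmul, LinearEquiv.prodCongr_apply,
      LinearEquiv.trans_apply, LinearEquiv.symm_apply_eq,
      TensorProduct.AlgebraTensorModule.distribBaseChange_tmul, TensorProduct.congr_tmul,
      TensorProduct.AlgebraTensorModule.rid_tmul, one_smul, hz,
      TensorProduct.AlgebraTensorModule.rid_symm_apply]
    clear hz
    induction z with
    | zero => simp
    | add a b ha hb =>
      simp only [map_add, TensorProduct.add_tmul, TensorProduct.tmul_add, Prod.fst_add, ha, hb]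
    | tmul a b =>
      rw [LinearMap.baseChange_tmul]
      simp
  · constructor
    · exact LinearMap.inl_injective.comp (LinearEquiv.injective _)
    · exact LinearMap.inl_injective.comp (LinearEquiv.injective _)

/-- The comparison isomorphism `c_M` of an `L`-de Rham–Betti object `M` over `K`, with `L ⊆ K`,
as a complex point of the `K`-scheme `Iso(M_dR, M_B ⊗ K)`, through
`(M_B ⊗ K) ⊗_K ℂ ≃ M_B ⊗ ℂ`. -/
def comparisonPoint [Algebra L K] [IsScalarTower L K ℂ] (M : Obj K L) :
    IsoPt K K M.dR (K ⊗[L] M.B) ℂ :=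
  M.c ≪≫ₗ (TensorProduct.AlgebraTensorModule.cancelBaseChange L K ℂ ℂ M.B).symm

/-- The base change `M ⊗ K = (M_dR, M_B ⊗ K, c_M)` of the Betti space from `L` to `K`. -/
abbrev extendBetti [Algebra L K] [IsScalarTower L K ℂ] (M : Obj K L) : Obj K K :=
  ⟨M.dR, K ⊗[L] M.B, M.comparisonPoint⟩

end Obj

end Category

/-! ### The Tannakian torsor -/

section Tannakian

variable {k : Type} [Field k] [Algebra k ℂ]

/-- An `R`-valued point of `Iso^⊗(ω_dR|⟨N⟩, ω_B|⟨N⟩)`: a family of `R`-linear isomorphisms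
`X_dR ⊗ R ≃ X_B ⊗ R`, for `X` in `⟨N⟩`, which is natural in `X` and compatible with the tensor
product and the unit object (both of which stay in `⟨N⟩`). -/
@[ext]
structure TensorIso (N : Obj k k) (R : Type) [CommRing R] [Algebra k R] : Type 1 where
  app : ∀ X : Obj k k, N.gen X → IsoPt k k X.dR X.B R
  naturality : ∀ (X Y : Obj k k) (hX : N.gen X) (hY : N.gen Y) (f : X ⟶ Y),
    (app Y hY).toLinearMap ∘ₗ f.dR.baseChange R = f.B.baseChange R ∘ₗ (app X hX).toLinearMap
  tensor : ∀ (X Y : Obj k k) (hX : N.gen X) (hY : N.gen Y) (hXY : N.gen (X.tensor Y)),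
    app (X.tensor Y) hXY = (app X hX).tensor (app Y hY)
  unit : ∀ h : N.gen (Obj.unit k k), app (Obj.unit k k) h = IsoPt.unit k k R

/-- The evaluation `Iso^⊗(ω_dR|⟨N⟩, ω_B|⟨N⟩) → Iso(N_dR, N_B)` at `N`, on `R`-valued points. -/
def TensorIso.eval {N : Obj k k} {R : Type} [CommRing R] [Algebra k R] (t : TensorIso N R) :
    IsoPt k k N.dR N.B R :=
  t.app N N.gen_self

/-- The Tannakian torsor of periods `Iso^⊗(ω_dR|⟨N⟩, ω_B|⟨N⟩)`, inside `Iso(N_dR, N_B)`: the image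
of the evaluation at `N`. -/
def torsorOfPeriods (N : Obj k k) : PointFamily k N.dR N.B :=
  fun R => Set.range fun t : TensorIso N R => t.eval

end Tannakian

/-- The algebraic closure of `ℚ` in `ℂ`. -/
abbrev Qbar : Type := algebraicClosure ℚ ℂ

end DRB

end

/-! A tensor isomorphism is determined by its value `f` at `N`. Compatibility with tensor products
and naturality for the evaluation pairing and for the inclusions of summands force its values on
tensor spaces; naturality then forces those on subobjects and on their quotients (`eval_injective`).
The question is which `f` occur, and `mem_torsorOfPeriods_iff` answers it: those whose extension to
every tensor space restricts to every subobject. To construct a tensor isomorphism from such an `f`,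
one must descend to subquotients independently of the presentation. Kernels of homomorphisms are
again subobjects, and a difference map on the direct sum of two presentations yields
well-definedness and naturality at once (`Restricts.baseChange_eq_iff`).

Preserving subobjects is a vanishing condition on matrix coefficients, hence closed. It is stable
under the heap operation `h ∘ g⁻¹ ∘ f`, and it holds for `N.c`, because a subobject carries a
comparison of its own. A rational point, which exists by the Nullstellensatz, turns a closed heap
into a subtorsor (`isSubtorsor_of_isHeap`).

Minimality is an argument in the style of Chevalley. Let `T` be a subtorsor containing `N.c`, with a
rational point `t₀`. An equation of `T` is a matrix coefficient `f ↦ m (f v)` on a tensor space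
(`exists_coeff_eq`). Let `U` be the span of the orbit `T v` in the Betti space. The heap law makes
`N.c` carry `t₀⁻¹ U` onto `U` after extension of scalars, so these two spaces form a subobject
(`exists_orbit_comparison`). It contains `v`, so every `f` preserving subobjects sends `v` into `U ⊗
R`, where `m` vanishes: `f` satisfies the equation. -/

noncomputable section

namespace DRB

namespace IsoPt

/-! ### Tensor products, sums and duals of isomorphisms over `R` -/

section Algebra

variable {k V W U V₁ W₁ U₁ V₂ W₂ U₂ V₃ W₃ V₄ W₄ R S : Type} [Field k]
  [AddCommGroup V] [Module k V] [AddCommGroup W] [Module k W] [AddCommGroup U] [Module k U]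
  [AddCommGroup V₁] [Module k V₁] [AddCommGroup W₁] [Module k W₁]
  [AddCommGroup U₁] [Module k U₁]
  [AddCommGroup V₂] [Module k V₂] [AddCommGroup W₂] [Module k W₂]
  [AddCommGroup U₂] [Module k U₂]
  [AddCommGroup V₃] [Module k V₃] [AddCommGroup W₃] [Module k W₃]
  [AddCommGroup V₄] [Module k V₄] [AddCommGroup W₄] [Module k W₄]
  [CommRing R] [Algebra k R] [CommRing S] [Algebra k S]

/-- The external product `(R ⊗ V₁) × (R ⊗ V₂) → R ⊗ (V₁ ⊗ V₂)`. -/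
def box : (R ⊗[k] V₁) →ₗ[R] (R ⊗[k] V₂) →ₗ[R] R ⊗[k] (V₁ ⊗[k] V₂) :=
  (TensorProduct.mk R (R ⊗[k] V₁) (R ⊗[k] V₂)).compr₂
    (TensorProduct.AlgebraTensorModule.distribBaseChange k R V₁ V₂).symm.toLinearMap

theorem tensor_box (f : IsoPt k k V₁ W₁ R) (g : IsoPt k k V₂ W₂ R)
    (x : R ⊗[k] V₁) (y : R ⊗[k] V₂) : f.tensor g (box x y) = box (f x) (g y) := by
  simp [tensor, box]

theorem box_tmul (r s : R) (v : V₁) (w : V₂) :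
    box (r ⊗ₜ[k] v) (s ⊗ₜ[k] w) = (r * s) ⊗ₜ (v ⊗ₜ w) := by
  have h : box ((1 : R) ⊗ₜ[k] v) ((1 : R) ⊗ₜ[k] w) = (1 : R) ⊗ₜ (v ⊗ₜ w) := by
    simp [box]
  have hr : r ⊗ₜ[k] v = r • ((1 : R) ⊗ₜ[k] v) := by simp [TensorProduct.smul_tmul']
  have hs : s ⊗ₜ[k] w = s • ((1 : R) ⊗ₜ[k] w) := by simp [TensorProduct.smul_tmul']
  rw [hr, hs, map_smul, map_smul, LinearMap.smul_apply, h, TensorProduct.smul_tmul',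
    TensorProduct.smul_tmul']
  simp [mul_comm]

/-- External products span over `R`, since `1 ⊗ (v ⊗ w)` is one of them. Identities on tensor
products are therefore checked on `box x y`, where `tensor_box` computes. -/
theorem hom_ext_box {f g : R ⊗[k] (V₁ ⊗[k] V₂) →ₗ[R] R ⊗[k] W}
    (h : ∀ x y, f (box x y) = g (box x y)) : f = g := by
  ext v w
  have := h (1 ⊗ₜ v) (1 ⊗ₜ w)
  simpa [box_tmul] using this

theorem ext_box {f g : IsoPt k k (V₁ ⊗[k] V₂) W R} (h : ∀ x y, f (box x y) = g (box x y)) :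
    f = g :=
  LinearEquiv.toLinearMap_injective (hom_ext_box h)

theorem baseChange_map_box (a : V₁ →ₗ[k] W₁) (b : V₂ →ₗ[k] W₂) (x : R ⊗[k] V₁) (y : R ⊗[k] V₂) :
    (TensorProduct.map a b).baseChange R (box x y) = box (a.baseChange R x) (b.baseChange R y) := by
  induction x with
  | zero => simp
  | add x x' hx hx' => simp only [map_add, LinearMap.add_apply, hx, hx']
  | tmul r v =>
    induction y with
    | zero => simp
    | add y y' hy hy' => simp only [map_add, hy, hy']
    | tmul s w => simp [box_tmul]

theorem rTensor_box (φ : R →ₐ[k] S) (x : R ⊗[k] V₁) (y : R ⊗[k] V₂) :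
    φ.toLinearMap.rTensor (V₁ ⊗[k] V₂) (box x y) =
      box (φ.toLinearMap.rTensor V₁ x) (φ.toLinearMap.rTensor V₂ y) := by
  induction x with
  | zero => simp
  | add x x' hx hx' => simp only [map_add, LinearMap.add_apply, hx, hx']
  | tmul r v =>
    induction y with
    | zero => simp
    | add y y' hy hy' => simp only [map_add, hy, hy']
    | tmul s w => simp [box_tmul]

theorem baseChange_assoc_box (x : R ⊗[k] V₁) (y : R ⊗[k] V₂) (z : R ⊗[k] V₃) :
    (TensorProduct.assoc k V₁ V₂ V₃).toLinearMap.baseChange R (box (box x y) z) =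
      box x (box y z) := by
  induction x with
  | zero => simp
  | add x x' hx hx' => simp only [map_add, LinearMap.add_apply, hx, hx']
  | tmul r v =>
    induction y with
    | zero => simp
    | add y y' hy hy' => simp only [map_add, LinearMap.add_apply, hy, hy']
    | tmul s w =>
      induction z with
      | zero => simp
      | add y y' hy hy' => simp only [map_add, hy, hy']
      | tmul t u => simp [box_tmul, mul_assoc]

theorem baseChange_comm_box (x : R ⊗[k] V₁) (y : R ⊗[k] V₂) :
    (TensorProduct.comm k V₁ V₂).toLinearMap.baseChange R (box x y) = box y x := by
  induction x with
  | zero => simp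
  | add x x' hx hx' => simp only [map_add, LinearMap.add_apply, hx, hx']
  | tmul r v =>
    induction y with
    | zero => simp
    | add y y' hy hy' => simp only [map_add, LinearMap.add_apply, hy, hy']
    | tmul s w => simp [box_tmul, mul_comm]

theorem baseChange_lid_box (x : R ⊗[k] k) (y : R ⊗[k] V) :
    (TensorProduct.lid k V).toLinearMap.baseChange R (box x y) =
      TensorProduct.AlgebraTensorModule.rid k R R x • y := by
  induction x with
  | zero => simp
  | add x x' hx hx' => simp only [map_add, LinearMap.add_apply, hx, hx', add_smul]
  | tmul r v =>
    induction y with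
    | zero => simp
    | add y y' hy hy' => simp only [map_add, hy, hy', smul_add]
    | tmul s w => simp [box_tmul, TensorProduct.smul_tmul']

/-! ### Composition and change of rings -/

theorem unit_eq_refl : unit k k R = LinearEquiv.refl R (R ⊗[k] k) := by
  ext x
  simp [unit]

theorem tensor_trans (f : IsoPt k k V₁ W₁ R) (g : IsoPt k k V₂ W₂ R)
    (f' : IsoPt k k W₁ U₁ R) (g' : IsoPt k k W₂ U₂ R) :
    tensor (K := k) (L := k) (f ≪≫ₗ f') (g ≪≫ₗ g') = f.tensor g ≪≫ₗ f'.tensor g' :=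
  ext_box fun x y => by simp [tensor_box]

theorem tensor_symm (f : IsoPt k k V₁ W₁ R) (g : IsoPt k k V₂ W₂ R) :
    (f.tensor g).symm = tensor (K := k) (L := k) f.symm g.symm :=
  ext_box fun x y => by
    rw [LinearEquiv.symm_apply_eq, tensor_box, tensor_box, LinearEquiv.apply_symm_apply,
      LinearEquiv.apply_symm_apply]

theorem map_rTensor (φ : R →ₐ[k] S) (f : IsoPt k k V W R) (x : R ⊗[k] V) :
    f.map φ (φ.toLinearMap.rTensor V x) = φ.toLinearMap.rTensor W (f x) :=
  mapHom_rTensor φ f.toLinearMap x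

/-- The image of `R ⊗ V` contains all `1 ⊗ v`, which span `S ⊗ V` over `S`. -/
theorem map_eq_of_rTensor (φ : R →ₐ[k] S) (f : IsoPt k k V W R) (g : IsoPt k k V W S)
    (h : ∀ x, g (φ.toLinearMap.rTensor V x) = φ.toLinearMap.rTensor W (f x)) : f.map φ = g := by
  apply LinearEquiv.toLinearMap_injective
  ext v
  have h1 := h (1 ⊗ₜ v)
  have h2 := map_rTensor φ f (1 ⊗ₜ v)
  simp only [LinearMap.rTensor_tmul, AlgHom.toLinearMap_apply, map_one] at h1 h2
  simp [h1, h2]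

theorem map_trans (φ : R →ₐ[k] S) (f : IsoPt k k V W R) (g : IsoPt k k W U R) :
    map (k := k) φ (f ≪≫ₗ g) = f.map φ ≪≫ₗ g.map φ :=
  map_eq_of_rTensor _ _ _ fun x => by simp [map_rTensor]

theorem map_symm (φ : R →ₐ[k] S) (f : IsoPt k k V W R) :
    map (k := k) φ f.symm = (f.map φ).symm :=
  rfl

theorem map_map {T : Type} [CommRing T] [Algebra k T] (φ : R →ₐ[k] S) (ψ : S →ₐ[k] T)
    (f : IsoPt k k V W R) : (f.map φ).map ψ = f.map (ψ.comp φ) := by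
  symm
  apply map_eq_of_rTensor
  intro x
  simp only [AlgHom.comp_toLinearMap, LinearMap.rTensor_comp, LinearMap.comp_apply, map_rTensor]

theorem map_refl (φ : R →ₐ[k] S) :
    map (k := k) φ (LinearEquiv.refl R (R ⊗[k] V)) = LinearEquiv.refl S (S ⊗[k] V) :=
  map_eq_of_rTensor _ _ _ fun x => by simp

theorem map_tensor (φ : R →ₐ[k] S) (f : IsoPt k k V₁ W₁ R) (g : IsoPt k k V₂ W₂ R) :
    (f.tensor g).map φ = (f.map φ).tensor (g.map φ) := by
  apply LinearEquiv.toLinearMap_injective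
  ext v w
  have h1 := map_rTensor φ (f.tensor g) (box (1 ⊗ₜ v) (1 ⊗ₜ w))
  have h2 : (f.map φ).tensor (g.map φ) (φ.toLinearMap.rTensor _ (box (1 ⊗ₜ v) (1 ⊗ₜ w))) =
      φ.toLinearMap.rTensor _ (f.tensor g (box (1 ⊗ₜ v) (1 ⊗ₜ w))) := by
    simp only [tensor_box, rTensor_box, map_rTensor]
  rw [← h2] at h1
  simpa [box_tmul] using h1

/-! ### Compatible pairs of linear maps -/

/-- The pair of linear maps `(a, b)` carries the isomorphism `f` to the isomorphism `g`. -/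
def Compat (f : IsoPt k k V₁ W₁ R) (g : IsoPt k k V₂ W₂ R) (a : V₁ →ₗ[k] V₂)
    (b : W₁ →ₗ[k] W₂) : Prop :=
  g.toLinearMap ∘ₗ a.baseChange R = b.baseChange R ∘ₗ f.toLinearMap

namespace Compat

variable {f : IsoPt k k V₁ W₁ R} {g : IsoPt k k V₂ W₂ R} {h : IsoPt k k V₃ W₃ R}
  {e : IsoPt k k V₄ W₄ R}

theorem apply {a : V₁ →ₗ[k] V₂} {b : W₁ →ₗ[k] W₂} (H : Compat f g a b) (x : R ⊗[k] V₁) :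
    g (a.baseChange R x) = b.baseChange R (f x) :=
  LinearMap.congr_fun H x

theorem of_apply {a : V₁ →ₗ[k] V₂} {b : W₁ →ₗ[k] W₂}
    (H : ∀ x, g (a.baseChange R x) = b.baseChange R (f x)) : Compat f g a b :=
  LinearMap.ext H

theorem symm_apply {a : V₁ →ₗ[k] V₂} {b : W₁ →ₗ[k] W₂} (H : Compat f g a b) (x : R ⊗[k] W₁) :
    g.symm (b.baseChange R x) = a.baseChange R (f.symm x) := by
  rw [LinearEquiv.symm_apply_eq, H.apply, LinearEquiv.apply_symm_apply]

theorem refl : Compat f f LinearMap.id LinearMap.id :=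
  of_apply fun x => by simp

theorem comp {a : V₁ →ₗ[k] V₂} {b : W₁ →ₗ[k] W₂} {a' : V₂ →ₗ[k] V₃} {b' : W₂ →ₗ[k] W₃}
    (H' : Compat g h a' b') (H : Compat f g a b) : Compat f h (a' ∘ₗ a) (b' ∘ₗ b) :=
  of_apply fun x => by
    simp only [LinearMap.baseChange_comp, LinearMap.comp_apply, H'.apply, H.apply]

theorem symm {a : V₁ ≃ₗ[k] V₂} {b : W₁ ≃ₗ[k] W₂} (H : Compat f g a.toLinearMap b.toLinearMap) :
    Compat g f a.symm.toLinearMap b.symm.toLinearMap :=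
  of_apply fun x => by
    have h1 := H.apply (a.symm.toLinearMap.baseChange R x)
    rw [← LinearMap.comp_apply, ← LinearMap.baseChange_comp, LinearEquiv.comp_symm] at h1
    have h2 := congrArg (b.symm.toLinearMap.baseChange R) h1
    rw [← LinearMap.comp_apply (LinearMap.baseChange R _) (LinearMap.baseChange R _),
      ← LinearMap.baseChange_comp, LinearEquiv.symm_comp] at h2
    simpa using h2.symm

theorem trans_iso {f' : IsoPt k k W₁ U₁ R} {g' : IsoPt k k W₂ U₂ R} {a : V₁ →ₗ[k] V₂}
    {b : W₁ →ₗ[k] W₂} {d : U₁ →ₗ[k] U₂} (H : Compat f g a b) (H' : Compat f' g' b d) :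
    Compat (k := k) (f ≪≫ₗ f') (g ≪≫ₗ g') a d :=
  of_apply fun x => by simp only [LinearEquiv.trans_apply, H.apply, H'.apply]

theorem symm_iso {a : V₁ →ₗ[k] V₂} {b : W₁ →ₗ[k] W₂} (H : Compat f g a b) :
    Compat (k := k) f.symm g.symm b a :=
  of_apply H.symm_apply

theorem tensor {a : V₁ →ₗ[k] V₂} {b : W₁ →ₗ[k] W₂} {a' : V₃ →ₗ[k] V₄} {b' : W₃ →ₗ[k] W₄}
    (H : Compat f g a b) (H' : Compat h e a' b') :
    Compat (f.tensor h) (g.tensor e) (TensorProduct.map a a') (TensorProduct.map b b') :=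
  hom_ext_box fun x y => by
    simp only [LinearMap.comp_apply, LinearEquiv.coe_coe, baseChange_map_box, tensor_box, H.apply,
      H'.apply]

theorem assoc : Compat ((f.tensor g).tensor h) (f.tensor (g.tensor h))
    (TensorProduct.assoc k V₁ V₂ V₃).toLinearMap (TensorProduct.assoc k W₁ W₂ W₃).toLinearMap := by
  apply LinearMap.ext
  intro t
  have key : ((f.tensor (g.tensor h)).toLinearMap ∘ₗ
      (TensorProduct.assoc k V₁ V₂ V₃).toLinearMap.baseChange R) =
      (TensorProduct.assoc k W₁ W₂ W₃).toLinearMap.baseChange R ∘ₗ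
        ((f.tensor g).tensor h).toLinearMap := by
    ext u v w
    have h1 : (1 : R) ⊗ₜ[k] ((u ⊗ₜ[k] v) ⊗ₜ[k] w) =
        box (box (1 ⊗ₜ u) (1 ⊗ₜ v)) (1 ⊗ₜ w) := by simp [box_tmul]
    simp only [TensorProduct.AlgebraTensorModule.curry_apply, LinearMap.restrictScalars_self,
      TensorProduct.curry_apply, LinearMap.coe_restrictScalars, LinearMap.comp_apply,
      LinearEquiv.coe_coe, h1, baseChange_assoc_box, tensor_box]
  exact LinearMap.congr_fun key t

theorem tensor_comm : Compat (f.tensor g) (g.tensor f)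
    (TensorProduct.comm k V₁ V₂).toLinearMap (TensorProduct.comm k W₁ W₂).toLinearMap :=
  hom_ext_box fun x y => by
    simp only [LinearMap.comp_apply, LinearEquiv.coe_coe, baseChange_comm_box, tensor_box]

theorem lid : Compat ((unit k k R).tensor f) f
    (TensorProduct.lid k V₁).toLinearMap (TensorProduct.lid k W₁).toLinearMap :=
  hom_ext_box fun x y => by
    simp only [LinearMap.comp_apply, LinearEquiv.coe_coe, baseChange_lid_box, tensor_box,
      unit_eq_refl, map_smul, LinearEquiv.refl_apply]

/-! ### Direct sums -/

theorem inl : Compat f (f.prod g) (LinearMap.inl k V₁ V₂) (LinearMap.inl k W₁ W₂) :=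
  of_apply fun x => by
    have key : ∀ (A B : Type) [AddCommGroup A] [Module k A] [AddCommGroup B] [Module k B]
        (x : R ⊗[k] A), TensorProduct.prodRight k R R A B
          ((LinearMap.inl k A B).baseChange R x) = (x, 0) := by
      intro A B _ _ _ _ x
      induction x with
      | zero => rw [map_zero, map_zero]; rfl
      | add x y hx hy => rw [map_add, map_add, hx, hy]; simp
      | tmul r v => simp
    simp [prod, LinearEquiv.symm_apply_eq, key]

theorem inr : Compat g (f.prod g) (LinearMap.inr k V₁ V₂) (LinearMap.inr k W₁ W₂) :=
  of_apply fun x => by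
    have key : ∀ (A B : Type) [AddCommGroup A] [Module k A] [AddCommGroup B] [Module k B]
        (x : R ⊗[k] B), TensorProduct.prodRight k R R A B
          ((LinearMap.inr k A B).baseChange R x) = (0, x) := by
      intro A B _ _ _ _ x
      induction x with
      | zero => rw [map_zero, map_zero]; rfl
      | add x y hx hy => rw [map_add, map_add, hx, hy]; simp
      | tmul r v => simp
    simp [prod, LinearEquiv.symm_apply_eq, key]

end Compat

theorem hom_ext_prod {f g : R ⊗[k] (V₁ × V₂) →ₗ[R] R ⊗[k] W}
    (hl : ∀ x, f ((LinearMap.inl k V₁ V₂).baseChange R x) =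
      g ((LinearMap.inl k V₁ V₂).baseChange R x))
    (hr : ∀ x, f ((LinearMap.inr k V₁ V₂).baseChange R x) =
      g ((LinearMap.inr k V₁ V₂).baseChange R x)) : f = g := by
  ext v
  · have := hl (1 ⊗ₜ v)
    simpa using this
  · have := hr (1 ⊗ₜ v)
    simpa using this

theorem Compat.of_prod {f : IsoPt k k V₁ W₁ R} {g : IsoPt k k V₂ W₂ R} {h : IsoPt k k V W R}
    {a : V₁ × V₂ →ₗ[k] V} {b : W₁ × W₂ →ₗ[k] W}
    (hl : Compat f h (a ∘ₗ LinearMap.inl k V₁ V₂) (b ∘ₗ LinearMap.inl k W₁ W₂))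
    (hr : Compat g h (a ∘ₗ LinearMap.inr k V₁ V₂) (b ∘ₗ LinearMap.inr k W₁ W₂)) :
    Compat (f.prod g) h a b :=
  hom_ext_prod
    (fun x => by
      have := hl.apply x
      simp only [LinearMap.baseChange_comp, LinearMap.comp_apply] at this
      simp only [LinearMap.comp_apply, LinearEquiv.coe_coe, this, Compat.inl.apply])
    (fun x => by
      have := hr.apply x
      simp only [LinearMap.baseChange_comp, LinearMap.comp_apply] at this
      simp only [LinearMap.comp_apply, LinearEquiv.coe_coe, this, Compat.inr.apply])

theorem Compat.of_prod' {f : IsoPt k k V₁ W₁ R} {g : IsoPt k k V₂ W₂ R} {h : IsoPt k k V W R}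
    {a : V₁ × V₂ →ₗ[k] V} {b : W₁ × W₂ →ₗ[k] W} {a₁ : V₁ →ₗ[k] V} {b₁ : W₁ →ₗ[k] W}
    {a₂ : V₂ →ₗ[k] V} {b₂ : W₂ →ₗ[k] W} (hl : Compat f h a₁ b₁) (hr : Compat g h a₂ b₂)
    (ha₁ : ∀ x, a (x, 0) = a₁ x) (hb₁ : ∀ x, b (x, 0) = b₁ x)
    (ha₂ : ∀ x, a (0, x) = a₂ x) (hb₂ : ∀ x, b (0, x) = b₂ x) : Compat (f.prod g) h a b := by
  obtain rfl : a ∘ₗ LinearMap.inl k V₁ V₂ = a₁ := LinearMap.ext ha₁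
  obtain rfl : b ∘ₗ LinearMap.inl k W₁ W₂ = b₁ := LinearMap.ext hb₁
  obtain rfl : a ∘ₗ LinearMap.inr k V₁ V₂ = a₂ := LinearMap.ext ha₂
  obtain rfl : b ∘ₗ LinearMap.inr k W₁ W₂ = b₂ := LinearMap.ext hb₂
  exact of_prod hl hr

/-- The two inclusions jointly span. This lets naturality alone fix the value of a tensor
isomorphism on a direct sum. -/
theorem eq_prod_of_compat {f : IsoPt k k V₁ W₁ R} {g : IsoPt k k V₂ W₂ R}
    {h : IsoPt k k (V₁ × V₂) (W₁ × W₂) R}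
    (hl : Compat f h (LinearMap.inl k V₁ V₂) (LinearMap.inl k W₁ W₂))
    (hr : Compat g h (LinearMap.inr k V₁ V₂) (LinearMap.inr k W₁ W₂)) : h = f.prod g := by
  apply LinearEquiv.toLinearMap_injective
  exact hom_ext_prod
    (fun x => by simp only [LinearEquiv.coe_coe, hl.apply, Compat.inl.apply])
    (fun x => by simp only [LinearEquiv.coe_coe, hr.apply, Compat.inr.apply])

theorem baseChange_rTensor (φ : R →ₐ[k] S) (a : V₁ →ₗ[k] V₂) (x : R ⊗[k] V₁) :
    a.baseChange S (φ.toLinearMap.rTensor V₁ x) = φ.toLinearMap.rTensor V₂ (a.baseChange R x) := by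
  induction x with
  | zero => simp
  | add x y hx hy => simp only [map_add, hx, hy]
  | tmul r v => simp

theorem Compat.map (φ : R →ₐ[k] S) {f : IsoPt k k V₁ W₁ R} {g : IsoPt k k V₂ W₂ R}
    {a : V₁ →ₗ[k] V₂} {b : W₁ →ₗ[k] W₂} (H : Compat f g a b) :
    Compat (f.map φ) (g.map φ) a b := by
  apply LinearMap.ext
  intro t
  have key : (g.map φ).toLinearMap ∘ₗ a.baseChange S = b.baseChange S ∘ₗ (f.map φ).toLinearMap := by
    ext v
    have h1 : (1 : S) ⊗ₜ[k] v = φ.toLinearMap.rTensor V₁ (1 ⊗ₜ v) := by simp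
    simp only [TensorProduct.AlgebraTensorModule.curry_apply,
      TensorProduct.curry_apply, LinearMap.coe_restrictScalars, LinearMap.comp_apply,
      LinearEquiv.coe_coe, h1, baseChange_rTensor, map_rTensor, H.apply]
  exact LinearMap.congr_fun key t

theorem map_prod (φ : R →ₐ[k] S) (f : IsoPt k k V₁ W₁ R) (g : IsoPt k k V₂ W₂ R) :
    (f.prod g).map φ = (f.map φ).prod (g.map φ) :=
  eq_prod_of_compat (Compat.inl.map φ) (Compat.inr.map φ)

theorem prod_trans (f : IsoPt k k V₁ W₁ R) (g : IsoPt k k V₂ W₂ R)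
    (f' : IsoPt k k W₁ U₁ R) (g' : IsoPt k k W₂ U₂ R) :
    prod (K := k) (L := k) (f ≪≫ₗ f') (g ≪≫ₗ g') = f.prod g ≪≫ₗ f'.prod g' :=
  (eq_prod_of_compat (Compat.inl.trans_iso Compat.inl)
    (Compat.inr.trans_iso Compat.inr)).symm

theorem prod_symm (f : IsoPt k k V₁ W₁ R) (g : IsoPt k k V₂ W₂ R) :
    (f.prod g).symm = prod (K := k) (L := k) f.symm g.symm :=
  eq_prod_of_compat Compat.inl.symm_iso Compat.inr.symm_iso

theorem Compat.fst {f : IsoPt k k V₁ W₁ R} {g : IsoPt k k V₂ W₂ R} :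
    Compat (f.prod g) f (LinearMap.fst k V₁ V₂) (LinearMap.fst k W₁ W₂) := by
  refine of_prod ?_ ?_
  · simpa using Compat.refl
  · simp [Compat]

theorem Compat.snd {f : IsoPt k k V₁ W₁ R} {g : IsoPt k k V₂ W₂ R} :
    Compat (f.prod g) g (LinearMap.snd k V₁ V₂) (LinearMap.snd k W₁ W₂) := by
  refine of_prod ?_ ?_
  · simp [Compat]
  · simpa using Compat.refl

theorem Compat.add {f : IsoPt k k V₁ W₁ R} {g : IsoPt k k V₂ W₂ R} {a a' : V₁ →ₗ[k] V₂}
    {b b' : W₁ →ₗ[k] W₂} (H : Compat f g a b) (H' : Compat f g a' b') :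
    Compat f g (a + a') (b + b') :=
  of_apply fun x => by
    simp only [LinearMap.baseChange_add, LinearMap.add_apply, _root_.map_add, H.apply, H'.apply]

theorem Compat.neg {f : IsoPt k k V₁ W₁ R} {g : IsoPt k k V₂ W₂ R} {a : V₁ →ₗ[k] V₂}
    {b : W₁ →ₗ[k] W₂} (H : Compat f g a b) : Compat f g (-a) (-b) :=
  of_apply fun x => by
    simp only [LinearMap.baseChange_neg, LinearMap.neg_apply, _root_.map_neg, H.apply]

theorem Compat.of_subsingleton [Subsingleton V₁] {f : IsoPt k k V₁ W₁ R} {g : IsoPt k k V₂ W₂ R}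
    {a : V₁ →ₗ[k] V₂} {b : W₁ →ₗ[k] W₂} : Compat f g a b := by
  apply LinearMap.ext
  intro x
  have : x = 0 := Subsingleton.elim _ _
  rw [this, _root_.map_zero, _root_.map_zero]

/-! ### Contragredients -/

section Dual

variable [FiniteDimensional k V] [FiniteDimensional k W] [FiniteDimensional k U]

/-- The pairing of `R ⊗ V^∨` and `R ⊗ V` with values in `R`. -/
def pairing : R ⊗[k] Module.Dual k V ≃ₗ[R] Module.Dual R (R ⊗[k] V) :=
  (TensorProduct.isBaseChange k V R).toDualBaseChange

@[simp]
theorem pairing_tmul (r s : R) (l : Module.Dual k V) (v : V) :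
    pairing (r ⊗ₜ[k] l) (s ⊗ₜ[k] v) = s * (r * algebraMap k R (l v)) := by
  have h1 : s ⊗ₜ[k] v = s • (TensorProduct.mk k R V 1 v) := by simp [TensorProduct.smul_tmul']
  rw [h1, map_smul, pairing, IsBaseChange.toDualBaseChange_tmul, smul_eq_mul]

theorem pairing_dual (f : IsoPt k k V W R) (ξ : R ⊗[k] Module.Dual k V) (y : R ⊗[k] W) :
    pairing (f.dual ξ) y = pairing ξ (f.symm y) := by
  simp [dual, pairing]

theorem ext_pairing {ξ η : R ⊗[k] Module.Dual k V} (h : ∀ x, pairing ξ x = pairing η x) :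
    ξ = η :=
  pairing.injective (LinearMap.ext h)

theorem dual_trans (f : IsoPt k k V W R) (g : IsoPt k k W U R) :
    IsoPt.dual (K := k) (L := k) (f ≪≫ₗ g) = f.dual ≪≫ₗ g.dual := by
  refine LinearEquiv.ext fun ξ => ext_pairing fun x => ?_
  simp only [pairing_dual, LinearEquiv.trans_apply, LinearEquiv.symm_trans_apply]

theorem dual_symm (f : IsoPt k k V W R) :
    IsoPt.dual (K := k) (L := k) f.symm = f.dual.symm := by
  refine LinearEquiv.ext fun ξ => ?_
  rw [LinearEquiv.eq_symm_apply]
  refine ext_pairing fun x => ?_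
  simp only [pairing_dual, LinearEquiv.symm_symm, LinearEquiv.apply_symm_apply]

theorem pairing_rTensor (φ : R →ₐ[k] S) (ξ : R ⊗[k] Module.Dual k V) (x : R ⊗[k] V) :
    pairing (φ.toLinearMap.rTensor _ ξ) (φ.toLinearMap.rTensor _ x) = φ (pairing ξ x) := by
  induction ξ with
  | zero => simp
  | add x x' hx hx' => simp only [map_add, LinearMap.add_apply, hx, hx']
  | tmul r v =>
    induction x with
    | zero => simp
    | add y y' hy hy' => simp only [map_add, hy, hy']
    | tmul s w => simp

theorem map_dual (φ : R →ₐ[k] S) (f : IsoPt k k V W R) :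
    f.dual.map φ = (f.map φ).dual := by
  apply map_eq_of_rTensor
  intro ξ
  refine ext_pairing fun x => ?_
  rw [pairing_dual]
  have key : pairing (φ.toLinearMap.rTensor _ ξ) ∘ₗ (f.map φ).symm.toLinearMap =
      pairing (φ.toLinearMap.rTensor _ (f.dual ξ)) := by
    ext w
    have h1 : (1 : S) ⊗ₜ[k] w = φ.toLinearMap.rTensor W (1 ⊗ₜ w) := by simp
    simp only [TensorProduct.AlgebraTensorModule.curry_apply,
      TensorProduct.curry_apply, LinearMap.coe_restrictScalars, LinearMap.comp_apply,
      LinearEquiv.coe_coe, h1]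
    rw [← map_symm, map_rTensor, pairing_rTensor, pairing_rTensor, pairing_dual]
  exact LinearMap.congr_fun key x

theorem rid_baseChange_contractLeft_box (ξ : R ⊗[k] Module.Dual k V) (x : R ⊗[k] V) :
    TensorProduct.AlgebraTensorModule.rid k R R
      ((contractLeft k V).baseChange R (box ξ x)) = pairing ξ x := by
  induction ξ with
  | zero => simp
  | add x x' hx hx' => simp only [map_add, LinearMap.add_apply, hx, hx']
  | tmul r v =>
    induction x with
    | zero => simp
    | add y y' hy hy' => simp only [map_add, hy, hy']
    | tmul s w => simp [box_tmul, Algebra.smul_def]; ring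

theorem Compat.contractLeft {f : IsoPt k k V W R} :
    Compat (f.dual.tensor f) (IsoPt.unit k k R) (contractLeft k V) (contractLeft k W) :=
  hom_ext_box fun ξ x => by
    apply (TensorProduct.AlgebraTensorModule.rid k R R).injective
    simp only [LinearMap.comp_apply, LinearEquiv.coe_coe, tensor_box, unit_eq_refl,
      LinearEquiv.refl_apply, rid_baseChange_contractLeft_box, pairing_dual,
      LinearEquiv.symm_apply_apply]

/-- The pairing is perfect, so invariance of the evaluation map leaves no choice for the action on
the dual. -/
theorem eq_dual_of_compat {f : IsoPt k k V W R}
    {g : IsoPt k k (Module.Dual k V) (Module.Dual k W) R}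
    (H : Compat (g.tensor f) (IsoPt.unit k k R) (contractLeft k V) (contractLeft k W)) :
    g = f.dual := by
  refine LinearEquiv.ext fun ξ => ext_pairing fun x => ?_
  obtain ⟨x, rfl⟩ := f.surjective x
  have h1 := congrArg (TensorProduct.AlgebraTensorModule.rid k R R) (H.apply (box ξ x))
  rw [tensor_box, unit_eq_refl, LinearEquiv.refl_apply, rid_baseChange_contractLeft_box,
    rid_baseChange_contractLeft_box] at h1
  rw [← h1, pairing_dual, LinearEquiv.symm_apply_apply]

end Dual

/-! ### Restriction to subspaces -/

/-- An isomorphism which carries subspaces, and whose inverse carries them back, restricts to an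
isomorphism of the subspaces. -/
theorem exists_restrict (f : IsoPt k k V W R) {i : V₁ →ₗ[k] V} {j : W₁ →ₗ[k] W}
    (hi : Function.Injective i) (hj : Function.Injective j)
    (h : ∀ v, f (1 ⊗ₜ i v) ∈ LinearMap.range (j.baseChange R))
    (h' : ∀ w, f.symm (1 ⊗ₜ j w) ∈ LinearMap.range (i.baseChange R)) :
    ∃ g : IsoPt k k V₁ W₁ R, Compat g f i j := by
  -- Linear retractions `p` of `i` and `q` of `j` give the candidates `q ∘ f ∘ i` and `p ∘ f⁻¹ ∘ j`.
  -- The range hypotheses say that nothing is lost on applying `q` and `p`.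
  obtain ⟨p, hp⟩ := i.exists_leftInverse_of_injective (LinearMap.ker_eq_bot.mpr hi)
  obtain ⟨q, hq⟩ := j.exists_leftInverse_of_injective (LinearMap.ker_eq_bot.mpr hj)
  have hp' : ∀ x, p.baseChange R (i.baseChange R x) = x := fun x => by
    rw [← LinearMap.comp_apply, ← LinearMap.baseChange_comp, hp]; simp
  have hq' : ∀ x, q.baseChange R (j.baseChange R x) = x := fun x => by
    rw [← LinearMap.comp_apply, ← LinearMap.baseChange_comp, hq]; simp
  have key : ∀ x, f (i.baseChange R x) ∈ LinearMap.range (j.baseChange R) := fun x => by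
    induction x with
    | zero => simp
    | add x y hx hy => simp only [map_add]; exact add_mem hx hy
    | tmul r v =>
      have : r ⊗ₜ[k] i v = r • ((1 : R) ⊗ₜ[k] i v) := by simp [TensorProduct.smul_tmul']
      rw [LinearMap.baseChange_tmul, this, map_smul]
      exact Submodule.smul_mem _ _ (h v)
  have key' : ∀ x, f.symm (j.baseChange R x) ∈ LinearMap.range (i.baseChange R) := fun x => by
    induction x with
    | zero => simp
    | add x y hx hy => simp only [map_add]; exact add_mem hx hy
    | tmul r v =>
      have : r ⊗ₜ[k] j v = r • ((1 : R) ⊗ₜ[k] j v) := by simp [TensorProduct.smul_tmul']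
      rw [LinearMap.baseChange_tmul, this, map_smul]
      exact Submodule.smul_mem _ _ (h' v)
  have e : ∀ x, j.baseChange R (q.baseChange R (f (i.baseChange R x))) = f (i.baseChange R x) :=
    fun x => by obtain ⟨y, hy⟩ := key x; rw [← hy, hq']
  have e' : ∀ x, i.baseChange R (p.baseChange R (f.symm (j.baseChange R x))) =
      f.symm (j.baseChange R x) :=
    fun x => by obtain ⟨y, hy⟩ := key' x; rw [← hy, hp']
  refine ⟨LinearEquiv.ofLinearMap
    (q.baseChange R ∘ₗ f.toLinearMap ∘ₗ i.baseChange R)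
    (p.baseChange R ∘ₗ f.symm.toLinearMap ∘ₗ j.baseChange R) ?_ ?_, ?_⟩
  · apply LinearMap.ext
    intro x
    simp only [LinearMap.comp_apply, LinearEquiv.coe_coe, e', LinearEquiv.apply_symm_apply, hq',
      LinearMap.id_apply]
  · apply LinearMap.ext
    intro x
    simp only [LinearMap.comp_apply, LinearEquiv.coe_coe, e, LinearEquiv.symm_apply_apply, hp',
      LinearMap.id_apply]
  · refine Compat.of_apply fun x => ?_
    exact (e x).symm

theorem baseChange_injective {i : V →ₗ[k] W} (hi : Function.Injective i) :
    Function.Injective (i.baseChange R) :=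
  Module.Flat.lTensor_preserves_injective_linearMap (M := R) i hi

theorem baseChange_surjective {i : V →ₗ[k] W} (hi : Function.Surjective i) :
    Function.Surjective (i.baseChange R) :=
  LinearMap.lTensor_surjective R hi

/-- `R` is flat over the field `k`, so kernels commute with base change. -/
theorem mem_range_baseChange_ker (q : V →ₗ[k] W) (x : R ⊗[k] V) :
    x ∈ LinearMap.range ((LinearMap.ker q).subtype.baseChange R) ↔ q.baseChange R x = 0 := by
  have h := Module.Flat.lTensor_exact (M := R) (f := (LinearMap.ker q).subtype) (g := q)
    (LinearMap.exact_subtype_ker_map q)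
  exact (h x).symm

end Algebra

end IsoPt

/-! ### Functorial extension of isomorphisms to the tensor spaces of `N` -/

open IsoPt

variable {k : Type} [Field k] [Algebra k ℂ]

/-- An extension of the isomorphisms `N_dR ⊗ R → N_B ⊗ R` to isomorphisms `X_dR ⊗ R → X_B ⊗ R`,
natural in `R`, compatible with the ternary operation `(f, g, h) ↦ h ∘ g⁻¹ ∘ f`, and carrying
the comparison isomorphism of `N` to that of `X`. -/
structure Extension (N X : Obj k k) : Type 1 where
  app : ∀ {R : Type} [CommRing R] [Algebra k R],
    IsoPt k k N.dR N.B R → IsoPt k k X.dR X.B R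
  map_app : ∀ {R S : Type} [CommRing R] [Algebra k R] [CommRing S] [Algebra k S]
    (φ : R →ₐ[k] S) (f : IsoPt k k N.dR N.B R), (app f).map φ = app (f.map φ)
  heap : ∀ {R : Type} [CommRing R] [Algebra k R] (f g h : IsoPt k k N.dR N.B R),
    app (f ≪≫ₗ g.symm ≪≫ₗ h) = app f ≪≫ₗ (app g).symm ≪≫ₗ app h
  app_c : app N.c = X.c

namespace Extension

variable {N X Y Z X' Y' : Obj k k}

/-- The identical extension. -/
def self (N : Obj k k) : Extension N N where
  app f := f
  map_app _ _ := rfl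
  heap _ _ _ := rfl
  app_c := rfl

/-- The extension to the unit object. -/
def unit (N : Obj k k) : Extension N (Obj.unit k k) where
  app {R} _ _ _ := IsoPt.unit k k R
  map_app _ _ := by
    rw [unit_eq_refl, unit_eq_refl, map_refl]
  heap _ _ _ := by
    rw [unit_eq_refl]; rfl
  app_c := rfl

/-- The extension to the zero object. -/
def zero (N : Obj k k) : Extension N (Obj.zero k k) where
  app {R} _ _ _ := IsoPt.zero k k R
  map_app _ _ := LinearEquiv.ext fun _ => Subsingleton.elim _ _
  heap _ _ _ := LinearEquiv.ext fun _ => Subsingleton.elim _ _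
  app_c := rfl

/-- The extension to a tensor product. -/
def tensor (E : Extension N X) (F : Extension N Y) : Extension N (X.tensor Y) where
  app f := (E.app f).tensor (F.app f)
  map_app φ f := by rw [map_tensor, E.map_app, F.map_app]
  heap f g h := by rw [E.heap, F.heap, tensor_trans, tensor_trans, tensor_symm]
  app_c := by rw [E.app_c, F.app_c]

/-- The extension to a direct sum. -/
def prod (E : Extension N X) (F : Extension N Y) : Extension N (X.prod Y) where
  app f := (E.app f).prod (F.app f)
  map_app φ f := by rw [IsoPt.map_prod, E.map_app, F.map_app]
  heap f g h := by rw [E.heap, F.heap, prod_trans, prod_trans, prod_symm]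
  app_c := by rw [E.app_c, F.app_c]

/-- The extension to a dual. -/
def dual (E : Extension N X) : Extension N X.dual where
  app f := (E.app f).dual
  map_app φ f := by rw [map_dual, E.map_app]
  heap f g h := by rw [E.heap, dual_trans, dual_trans, dual_symm]
  app_c := by rw [E.app_c]

/-- The extension to tensor powers. -/
def tensorPow (E : Extension N X) : ∀ n : ℕ, Extension N (X.tensorPow n)
  | 0 => unit N
  | n + 1 => (E.tensorPow n).tensor E

/-- The extension to the tensor spaces of `N`. -/
def tensorSpace (N : Obj k k) : ∀ l : List (ℕ × ℕ), Extension N (N.tensorSpace l)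
  | [] => zero N
  | p :: l => (((self N).tensorPow p.1).tensor ((self N).dual.tensorPow p.2)).prod
      (tensorSpace N l)

/-- Two extensions are isomorphic if they correspond to each other through a pair of
isomorphisms. -/
def Iso (E : Extension N X) (F : Extension N Y) : Prop :=
  ∃ (a : X.dR ≃ₗ[k] Y.dR) (b : X.B ≃ₗ[k] Y.B),
    ∀ (R : Type) [CommRing R] [Algebra k R] (f : IsoPt k k N.dR N.B R),
      Compat (E.app f) (F.app f) a.toLinearMap b.toLinearMap

theorem Iso.refl (E : Extension N X) : E.Iso E :=
  ⟨LinearEquiv.refl k _, LinearEquiv.refl k _, fun _ _ _ _ => Compat.refl⟩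

theorem Iso.symm {E : Extension N X} {F : Extension N Y} : E.Iso F → F.Iso E :=
  fun ⟨a, b, h⟩ => ⟨a.symm, b.symm, fun R _ _ f => (h R f).symm⟩

theorem Iso.trans {E : Extension N X} {F : Extension N Y} {G : Extension N Z} :
    E.Iso F → F.Iso G → E.Iso G :=
  fun ⟨a, b, h⟩ ⟨a', b', h'⟩ => ⟨a ≪≫ₗ a', b ≪≫ₗ b', fun R _ _ f => (h' R f).comp (h R f)⟩

theorem Iso.tensor {E : Extension N X} {F : Extension N Y} {E' : Extension N X'}
    {F' : Extension N Y'} : E.Iso F → E'.Iso F' → (E.tensor E').Iso (F.tensor F') :=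
  fun ⟨a, b, h⟩ ⟨a', b', h'⟩ => ⟨TensorProduct.congr a a', TensorProduct.congr b b',
    fun R _ _ f => (h R f).tensor (h' R f)⟩

theorem Iso.prod {E : Extension N X} {F : Extension N Y} {E' : Extension N X'}
    {F' : Extension N Y'} : E.Iso F → E'.Iso F' → (E.prod E').Iso (F.prod F') :=
  fun ⟨a, b, h⟩ ⟨a', b', h'⟩ => ⟨a.prodCongr a', b.prodCongr b', fun R _ _ f =>
    Compat.of_prod' (Compat.inl.comp (h R f)) (Compat.inr.comp (h' R f))
      (fun x => by simp) (fun x => by simp) (fun x => by simp) (fun x => by simp)⟩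

theorem assoc_iso (E : Extension N X) (F : Extension N Y) (G : Extension N Z) :
    ((E.tensor F).tensor G).Iso (E.tensor (F.tensor G)) :=
  ⟨TensorProduct.assoc k _ _ _, TensorProduct.assoc k _ _ _, fun _ _ _ _ => Compat.assoc⟩

theorem comm_iso (E : Extension N X) (F : Extension N Y) : (E.tensor F).Iso (F.tensor E) :=
  ⟨TensorProduct.comm k _ _, TensorProduct.comm k _ _, fun _ _ _ _ => Compat.tensor_comm⟩

theorem lid_iso (E : Extension N X) : ((unit N).tensor E).Iso E :=
  ⟨TensorProduct.lid k _, TensorProduct.lid k _, fun _ _ _ _ => Compat.lid⟩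

theorem rid_iso (E : Extension N X) : (E.tensor (unit N)).Iso E :=
  (comm_iso _ _).trans E.lid_iso

theorem tensor_tensor_comm_iso (E : Extension N X) (E' : Extension N X') (F : Extension N Y)
    (F' : Extension N Y') :
    ((E.tensor E').tensor (F.tensor F')).Iso ((E.tensor F).tensor (E'.tensor F')) :=
  (assoc_iso _ _ _).trans <| ((Iso.refl E).tensor
    ((assoc_iso E' F F').symm.trans <| ((comm_iso E' F).tensor (Iso.refl F')).trans
      (assoc_iso F E' F'))).trans (assoc_iso _ _ _).symm

theorem prod_assoc_iso (E : Extension N X) (F : Extension N Y) (G : Extension N Z) :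
    ((E.prod F).prod G).Iso (E.prod (F.prod G)) :=
  ⟨LinearEquiv.prodAssoc k _ _ _, LinearEquiv.prodAssoc k _ _ _, fun _ _ _ _ =>
    Compat.of_prod'
      (Compat.of_prod' (a := LinearMap.prodMap LinearMap.id (LinearMap.inl k _ _))
        (b := LinearMap.prodMap LinearMap.id (LinearMap.inl k _ _))
        Compat.inl (Compat.inr.comp Compat.inl)
        (fun x => by simp) (fun x => by simp) (fun x => by simp) (fun x => by simp))
      (Compat.inr.comp Compat.inr)
      (fun x => by simp) (fun x => by simp) (fun x => by simp) (fun x => by simp)⟩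

theorem zero_prod_iso (E : Extension N X) : ((zero N).prod E).Iso E :=
  ⟨LinearEquiv.uniqueProd, LinearEquiv.uniqueProd, fun _ _ _ _ =>
    Compat.of_prod Compat.of_subsingleton Compat.refl⟩

theorem prod_zero_iso (E : Extension N X) : (E.prod (zero N)).Iso E :=
  ⟨LinearEquiv.prodUnique, LinearEquiv.prodUnique, fun _ _ _ _ =>
    Compat.of_prod Compat.refl Compat.of_subsingleton⟩

theorem zero_tensor_iso (E : Extension N X) : ((zero N).tensor E).Iso (zero N) := by
  refine ⟨⟨0, 0, fun x => ?_, fun x => Subsingleton.elim _ _⟩,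
    ⟨0, 0, fun x => ?_, fun x => Subsingleton.elim _ _⟩, fun _ _ _ f => ?_⟩
  · exact Subsingleton.elim _ _
  · exact Subsingleton.elim _ _
  · exact LinearMap.ext fun x => Subsingleton.elim _ _

theorem tensor_zero_iso (E : Extension N X) : (E.tensor (zero N)).Iso (zero N) :=
  (comm_iso _ _).trans E.zero_tensor_iso

theorem tensor_prod_iso (E : Extension N X) (F : Extension N Y) (G : Extension N Z) :
    (E.tensor (F.prod G)).Iso ((E.tensor F).prod (E.tensor G)) := by
  refine Iso.symm ⟨(TensorProduct.prodRight k k _ _ _).symm,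
    (TensorProduct.prodRight k k _ _ _).symm, fun _ _ _ f => ?_⟩
  -- Written through the two inclusions, the distributivity map can be checked on each summand by
  -- `Compat.of_prod`.
  have h : ∀ (A B C : Type) [AddCommGroup A] [Module k A] [AddCommGroup B] [Module k B]
      [AddCommGroup C] [Module k C],
      (TensorProduct.prodRight k k A B C).symm.toLinearMap =
        (TensorProduct.map LinearMap.id (LinearMap.inl k B C)).coprod
          (TensorProduct.map LinearMap.id (LinearMap.inr k B C)) := by
    intro A B C _ _ _ _ _ _
    ext <;> simp [LinearEquiv.symm_apply_eq]
  rw [h, h]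
  refine Compat.of_prod ?_ ?_
  · rw [LinearMap.coprod_inl, LinearMap.coprod_inl]
    exact Compat.refl.tensor Compat.inl
  · rw [LinearMap.coprod_inr, LinearMap.coprod_inr]
    exact Compat.refl.tensor Compat.inr

theorem tensorPow_add_iso (E : Extension N X) (m : ℕ) :
    ∀ n : ℕ, ((E.tensorPow m).tensor (E.tensorPow n)).Iso (E.tensorPow (m + n))
  | 0 => rid_iso _
  | n + 1 => (assoc_iso _ _ _).symm.trans ((E.tensorPow_add_iso m n).tensor (Iso.refl E))

/-- The extension is isomorphic to the extension to a tensor space of `N`. -/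
def IsTensorial (E : Extension N X) : Prop :=
  ∃ l : List (ℕ × ℕ), E.Iso (tensorSpace N l)

theorem IsTensorial.of_iso {E : Extension N X} {F : Extension N Y} (h : E.Iso F) :
    F.IsTensorial → E.IsTensorial :=
  fun ⟨l, hl⟩ => ⟨l, h.trans hl⟩

theorem isTensorial_tensorSpace (l : List (ℕ × ℕ)) : (tensorSpace N l).IsTensorial :=
  ⟨l, Iso.refl _⟩

theorem isTensorial_zero : (zero N).IsTensorial :=
  isTensorial_tensorSpace []

theorem isTensorial_tensorPow_tensor (m n : ℕ) :
    (((self N).tensorPow m).tensor ((self N).dual.tensorPow n)).IsTensorial :=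
  -- The tensor space of a one-element list still ends with a zero summand.
  ⟨[(m, n)], (prod_zero_iso _).symm⟩

theorem isTensorial_tensorPow (n : ℕ) : ((self N).tensorPow n).IsTensorial :=
  (isTensorial_tensorPow_tensor n 0).of_iso (rid_iso _).symm

theorem isTensorial_dual_tensorPow (n : ℕ) : ((self N).dual.tensorPow n).IsTensorial :=
  (isTensorial_tensorPow_tensor 0 n).of_iso (lid_iso _).symm

theorem isTensorial_unit : (unit N).IsTensorial :=
  isTensorial_tensorPow 0

theorem isTensorial_self : (self N).IsTensorial :=
  (isTensorial_tensorPow 1).of_iso (lid_iso _).symm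

theorem isTensorial_dual : (self N).dual.IsTensorial :=
  (isTensorial_dual_tensorPow 1).of_iso (lid_iso _).symm

theorem IsTensorial.prod {E : Extension N X} {F : Extension N Y} :
    E.IsTensorial → F.IsTensorial → (E.prod F).IsTensorial := by
  rintro ⟨l, hl⟩ ⟨l', hl'⟩
  refine IsTensorial.of_iso (hl.prod hl') ⟨l ++ l', ?_⟩
  clear hl hl'
  induction l with
  | nil => exact zero_prod_iso _
  | cons p l ih => exact (prod_assoc_iso _ _ _).trans ((Iso.refl _).prod ih)

/-- Distributivity over both lists reduces to single summands, where regrouping the factors adds the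
exponents. -/
theorem IsTensorial.tensor {E : Extension N X} {F : Extension N Y} :
    E.IsTensorial → F.IsTensorial → (E.tensor F).IsTensorial := by
  rintro ⟨l, hl⟩ ⟨l', hl'⟩
  refine IsTensorial.of_iso (hl.tensor hl') ?_
  clear hl hl'
  induction l with
  | nil => exact isTensorial_zero.of_iso (zero_tensor_iso _)
  | cons p l ih =>
    refine IsTensorial.of_iso ((comm_iso _ _).trans ((tensor_prod_iso _ _ _).trans
      ((comm_iso _ _).prod (comm_iso _ _)))) (IsTensorial.prod ?_ ih)
    clear ih
    induction l' with
    | nil => exact isTensorial_zero.of_iso (tensor_zero_iso _)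
    | cons q l' ih =>
      refine IsTensorial.of_iso (tensor_prod_iso _ _ _) (IsTensorial.prod ?_ ih)
      exact (isTensorial_tensorPow_tensor (p.1 + q.1) (p.2 + q.2)).of_iso
        ((tensor_tensor_comm_iso _ _ _ _).trans
          ((tensorPow_add_iso _ _ _).tensor (tensorPow_add_iso _ _ _)))

/-- A pair of linear maps which is compatible with two extensions is a homomorphism. -/
def hom (E : Extension N X) (F : Extension N Y) (a : X.dR →ₗ[k] Y.dR) (b : X.B →ₗ[k] Y.B)
    (h : ∀ (R : Type) [CommRing R] [Algebra k R] (f : IsoPt k k N.dR N.B R),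
      Compat (E.app f) (F.app f) a b) : X ⟶ Y :=
  ⟨a, b, by have := h ℂ N.c; rwa [E.app_c, F.app_c] at this⟩

theorem IsTensorial.gen {E : Extension N X} : E.IsTensorial → N.gen X :=
  fun ⟨l, a, b, h⟩ => ⟨l, X, hom E (tensorSpace N l) a.toLinearMap b.toLinearMap h, 𝟙 X,
    ⟨a.injective, b.injective⟩, Function.surjective_id, Function.surjective_id⟩

end Extension

/-! ### Descent of isomorphisms to subquotients -/

/-- An isomorphism which identifies the kernels of two surjections descends to their targets. -/
theorem IsoPt.exists_descend {k V₁ W₁ V W R : Type} [Field k]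
    [AddCommGroup V] [Module k V] [AddCommGroup W] [Module k W]
    [AddCommGroup V₁] [Module k V₁] [AddCommGroup W₁] [Module k W₁] [CommRing R] [Algebra k R]
    (g : IsoPt k k V₁ W₁ R) {p : V₁ →ₗ[k] V} {q : W₁ →ₗ[k] W}
    (hp : Function.Surjective p) (hq : Function.Surjective q)
    (H : ∀ z, p.baseChange R z = 0 ↔ q.baseChange R (g z) = 0) :
    ∃ h : IsoPt k k V W R, IsoPt.Compat g h p q := by
  -- The descended map is `q ∘ g ∘ s` for a linear section `s` of `p`. By `H` it does not matter
  -- that `s ∘ p` differs from the identity, as the difference lies in the kernel.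
  obtain ⟨s, hs⟩ := p.exists_rightInverse_of_surjective (LinearMap.range_eq_top.mpr hp)
  obtain ⟨t, ht⟩ := q.exists_rightInverse_of_surjective (LinearMap.range_eq_top.mpr hq)
  have hs' : ∀ x, p.baseChange R (s.baseChange R x) = x := fun x => by
    rw [← LinearMap.comp_apply, ← LinearMap.baseChange_comp, hs]; simp
  have ht' : ∀ x, q.baseChange R (t.baseChange R x) = x := fun x => by
    rw [← LinearMap.comp_apply, ← LinearMap.baseChange_comp, ht]; simp
  have e : ∀ z, q.baseChange R (g (s.baseChange R (p.baseChange R z))) =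
      q.baseChange R (g z) := fun z => by
    have := (H (s.baseChange R (p.baseChange R z) - z)).mp (by rw [map_sub, hs', sub_self])
    rwa [map_sub, map_sub, sub_eq_zero] at this
  have e' : ∀ z, p.baseChange R (g.symm (t.baseChange R (q.baseChange R z))) =
      p.baseChange R (g.symm z) := fun z => by
    have := (H (g.symm (t.baseChange R (q.baseChange R z)) - g.symm z)).mpr
      (by rw [map_sub, LinearEquiv.apply_symm_apply, LinearEquiv.apply_symm_apply, map_sub, ht',
        sub_self])
    rwa [map_sub, sub_eq_zero] at this
  refine ⟨LinearEquiv.ofLinearMap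
    (q.baseChange R ∘ₗ g.toLinearMap ∘ₗ s.baseChange R)
    (p.baseChange R ∘ₗ g.symm.toLinearMap ∘ₗ t.baseChange R) ?_ ?_, ?_⟩
  · apply LinearMap.ext
    intro x
    simp only [LinearMap.comp_apply, LinearEquiv.coe_coe, e, LinearEquiv.apply_symm_apply, ht',
      LinearMap.id_apply]
  · apply LinearMap.ext
    intro x
    simp only [LinearMap.comp_apply, LinearEquiv.coe_coe, e', LinearEquiv.symm_apply_apply, hs',
      LinearMap.id_apply]
  · exact Compat.of_apply fun x => e x

open IsoPt

variable {k : Type} [Field k] [Algebra k ℂ]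

theorem Hom.compat {X Y : Obj k k} (h : X ⟶ Y) : Compat X.c Y.c h.dR h.B :=
  h.comm

/-- The kernels of the components of a homomorphism form an object. -/
theorem exists_ker_comparison {X Y : Obj k k} (q : X ⟶ Y) :
    ∃ c : IsoPt k k (LinearMap.ker q.dR) (LinearMap.ker q.B) ℂ,
      Compat c X.c (LinearMap.ker q.dR).subtype (LinearMap.ker q.B).subtype := by
  refine exists_restrict X.c (Submodule.injective_subtype _) (Submodule.injective_subtype _)
    (fun v => ?_) (fun w => ?_)
  · rw [mem_range_baseChange_ker, ← (Hom.compat q).apply, LinearMap.baseChange_tmul]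
    simp
  · rw [mem_range_baseChange_ker]
    apply Y.c.injective
    rw [(Hom.compat q).apply, LinearEquiv.apply_symm_apply, LinearMap.baseChange_tmul]
    simp

namespace Extension

variable {N X Y Z S S' : Obj k k} {R : Type} [CommRing R] [Algebra k R]

/-- The extensions of `f` to the tensor spaces of `N` restrict to isomorphisms of their
subobjects. -/
def PreservesSubobjects (f : IsoPt k k N.dR N.B R) : Prop :=
  ∀ (l : List (ℕ × ℕ)) (S : Obj k k) (i : S ⟶ N.tensorSpace l),
    Function.Injective i.dR → Function.Injective i.B →
      ∃ g : IsoPt k k S.dR S.B R, Compat g ((tensorSpace N l).app f) i.dR i.B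

variable {f : IsoPt k k N.dR N.B R}

/-- The subobject is transported to a tensor space of `N`, and the compatibility is transported
back. -/
theorem PreservesSubobjects.exists_compat (hf : PreservesSubobjects f) {E : Extension N X}
    (hE : E.IsTensorial) (i : S ⟶ X) (hi : Function.Injective i.dR)
    (hi' : Function.Injective i.B) :
    ∃ g : IsoPt k k S.dR S.B R, Compat g (E.app f) i.dR i.B := by
  obtain ⟨l, a, b, h⟩ := hE
  obtain ⟨g, hg⟩ := hf l S (i ≫ hom E (tensorSpace N l) a.toLinearMap b.toLinearMap h)
    (a.injective.comp hi) (b.injective.comp hi')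
  refine ⟨g, ?_⟩
  have h1 := (h R f).symm.comp hg
  have ha : a.symm.toLinearMap ∘ₗ (a.toLinearMap ∘ₗ i.dR) = i.dR := by ext; simp
  have hb : b.symm.toLinearMap ∘ₗ (b.toLinearMap ∘ₗ i.B) = i.B := by ext; simp
  change Compat g (E.app f) (a.symm.toLinearMap ∘ₗ (a.toLinearMap ∘ₗ i.dR))
    (b.symm.toLinearMap ∘ₗ (b.toLinearMap ∘ₗ i.B)) at h1
  rwa [ha, hb] at h1

/-- The kernel of `q` is itself a subobject of `X`, so `f` restricts to an isomorphism between the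
de Rham and Betti kernels. Injectivity of `i.B` identifies it with the restriction of `g`, and
flatness identifies the kernels over `R`. -/
theorem PreservesSubobjects.baseChange_eq_zero_iff (hf : PreservesSubobjects f)
    {E : Extension N X} (hE : E.IsTensorial) (i : S ⟶ X) (hi : Function.Injective i.dR)
    (hi' : Function.Injective i.B) {g : IsoPt k k S.dR S.B R}
    (hg : Compat g (E.app f) i.dR i.B) (q : S ⟶ Y) (z : R ⊗[k] S.dR) :
    q.dR.baseChange R z = 0 ↔ q.B.baseChange R (g z) = 0 := by
  obtain ⟨c, hc⟩ := exists_ker_comparison q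
  let K : Obj k k := ⟨LinearMap.ker q.dR, LinearMap.ker q.B, c⟩
  let j : K ⟶ S := ⟨(LinearMap.ker q.dR).subtype, (LinearMap.ker q.B).subtype, hc⟩
  obtain ⟨e, he⟩ := hf.exists_compat hE (j ≫ i)
    (hi.comp (Submodule.injective_subtype _)) (hi'.comp (Submodule.injective_subtype _))
  have he' : Compat e g (LinearMap.ker q.dR).subtype (LinearMap.ker q.B).subtype :=
    Compat.of_apply fun x => by
      apply baseChange_injective hi'
      rw [← hg.apply]
      have h2 := he.apply x
      change E.app f ((i.dR ∘ₗ (LinearMap.ker q.dR).subtype).baseChange R x) =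
        (i.B ∘ₗ (LinearMap.ker q.B).subtype).baseChange R (e x) at h2
      rwa [LinearMap.baseChange_comp, LinearMap.baseChange_comp] at h2
  rw [← mem_range_baseChange_ker, ← mem_range_baseChange_ker]
  constructor
  · rintro ⟨x, rfl⟩
    exact ⟨e x, (he'.apply x).symm⟩
  · rintro ⟨x, hx⟩
    refine ⟨e.symm x, ?_⟩
    rw [← he'.symm_apply, hx, LinearEquiv.symm_apply_apply]

/-- A presentation of `X` as a subquotient of an object to which isomorphisms extend. -/
structure Presentation (N X : Obj k k) : Type 1 where
  {ambient : Obj k k}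
  extension : Extension N ambient
  isTensorial : extension.IsTensorial
  {sub : Obj k k}
  incl : sub ⟶ ambient
  proj : sub ⟶ X
  incl_dR : Function.Injective incl.dR
  incl_B : Function.Injective incl.B
  proj_dR : Function.Surjective proj.dR
  proj_B : Function.Surjective proj.B

theorem nonempty_presentation (hX : N.gen X) : Nonempty (Presentation N X) := by
  obtain ⟨l, S, i, p, ⟨h1, h2⟩, h3, h4⟩ := hX
  exact ⟨⟨tensorSpace N l, isTensorial_tensorSpace l, i, p, h1, h2, h3, h4⟩⟩

/-- The presentation of an object to which isomorphisms extend. -/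
def IsTensorial.presentation {E : Extension N X} (hE : E.IsTensorial) : Presentation N X :=
  ⟨E, hE, 𝟙 X, 𝟙 X, Function.injective_id, Function.injective_id,
    Function.surjective_id, Function.surjective_id⟩

namespace Presentation

/-- The isomorphism `g` is the restriction of the extension of `f`. -/
def Restricts (P : Presentation N X) (f : IsoPt k k N.dR N.B R)
    (g : IsoPt k k P.sub.dR P.sub.B R) : Prop :=
  Compat g (P.extension.app f) P.incl.dR P.incl.B

theorem exists_restricts (P : Presentation N X) (hf : PreservesSubobjects f) :
    ∃ g, P.Restricts f g :=
  hf.exists_compat P.isTensorial P.incl P.incl_dR P.incl_B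

/-- Both sides say that a pair is killed by the homomorphism `h ∘ P.proj - Q.proj` on the direct sum
of the two subobjects, so `baseChange_eq_zero_iff` applies there. With `h` the identity this gives
descent and independence of the presentation; for general `h` it gives naturality. -/
theorem Restricts.baseChange_eq_iff (hf : PreservesSubobjects f) {P : Presentation N X}
    {Q : Presentation N Y} {g : IsoPt k k P.sub.dR P.sub.B R} {g' : IsoPt k k Q.sub.dR Q.sub.B R}
    (hg : P.Restricts f g) (hg' : Q.Restricts f g') (h : X ⟶ Y)
    (z : R ⊗[k] P.sub.dR) (z' : R ⊗[k] Q.sub.dR) :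
    h.dR.baseChange R (P.proj.dR.baseChange R z) = Q.proj.dR.baseChange R z' ↔
      h.B.baseChange R (P.proj.B.baseChange R (g z)) = Q.proj.B.baseChange R (g' z') := by
  let i : P.sub.prod Q.sub ⟶ P.ambient.prod Q.ambient :=
    ⟨P.incl.dR.prodMap Q.incl.dR, P.incl.B.prodMap Q.incl.B,
      Compat.of_prod' (Compat.inl.comp (Hom.compat P.incl)) (Compat.inr.comp (Hom.compat Q.incl))
        (fun x => by simp) (fun x => by simp) (fun x => by simp) (fun x => by simp)⟩
  let q : P.sub.prod Q.sub ⟶ Y :=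
    ⟨(h.dR ∘ₗ P.proj.dR) ∘ₗ LinearMap.fst k _ _ + -(Q.proj.dR ∘ₗ LinearMap.snd k _ _),
      (h.B ∘ₗ P.proj.B) ∘ₗ LinearMap.fst k _ _ + -(Q.proj.B ∘ₗ LinearMap.snd k _ _),
      ((((Hom.compat h).comp (Hom.compat P.proj)).comp Compat.fst).add
        ((Hom.compat Q.proj).comp Compat.snd).neg)⟩
  have hc : Compat (g.prod g') ((P.extension.prod Q.extension).app f) i.dR i.B :=
    Compat.of_prod' (Compat.inl.comp hg) (Compat.inr.comp hg')
      (fun x => by simp [i]) (fun x => by simp [i]) (fun x => by simp [i]) (fun x => by simp [i])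
  have key := hf.baseChange_eq_zero_iff (P.isTensorial.prod Q.isTensorial) i
    (P.incl_dR.prodMap Q.incl_dR) (P.incl_B.prodMap Q.incl_B) hc q
    ((LinearMap.inl k _ _).baseChange R z + (LinearMap.inr k _ _).baseChange R z')
  have e : ∀ {A B C : Type} [AddCommGroup A] [Module k A] [AddCommGroup B] [Module k B]
      [AddCommGroup C] [Module k C] (u : A →ₗ[k] C) (v : B →ₗ[k] C) (x : R ⊗[k] A)
      (y : R ⊗[k] B),
      (u ∘ₗ LinearMap.fst k A B + -(v ∘ₗ LinearMap.snd k A B)).baseChange R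
        ((LinearMap.inl k A B).baseChange R x + (LinearMap.inr k A B).baseChange R y) =
      u.baseChange R x - v.baseChange R y := by
    intro A B C _ _ _ _ _ _ u v x y
    rw [map_add, ← LinearMap.comp_apply, ← LinearMap.comp_apply, ← LinearMap.baseChange_comp,
      ← LinearMap.baseChange_comp, LinearMap.add_comp, LinearMap.add_comp, LinearMap.neg_comp,
      LinearMap.neg_comp, LinearMap.comp_assoc, LinearMap.comp_assoc, LinearMap.comp_assoc,
      LinearMap.comp_assoc, LinearMap.fst_comp_inl, LinearMap.snd_comp_inl,
      LinearMap.fst_comp_inr, LinearMap.snd_comp_inr]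
    simp [sub_eq_add_neg, LinearMap.baseChange_neg]
  have e₁ := e (h.dR ∘ₗ P.proj.dR) Q.proj.dR z z'
  have e₂ := e (h.B ∘ₗ P.proj.B) Q.proj.B (g z) (g' z')
  rw [map_add (g.prod g'), Compat.inl.apply, Compat.inr.apply] at key
  rw [show q.dR.baseChange R _ = _ from e₁, show q.B.baseChange R _ = _ from e₂, sub_eq_zero,
    sub_eq_zero] at key
  simpa only [LinearMap.baseChange_comp, LinearMap.comp_apply] using key

/-- The isomorphism descends from one presentation, yet is compatible with all of them; later
arguments may thus use whichever presentation is convenient. -/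
theorem exists_compat_proj (hf : PreservesSubobjects f) (hX : N.gen X) :
    ∃ h : IsoPt k k X.dR X.B R, ∀ (P : Presentation N X) (g : IsoPt k k P.sub.dR P.sub.B R),
      P.Restricts f g → Compat g h P.proj.dR P.proj.B := by
  obtain ⟨P⟩ := nonempty_presentation hX
  obtain ⟨g, hg⟩ := P.exists_restricts hf
  have key : ∀ (Q : Presentation N X) (g' : IsoPt k k Q.sub.dR Q.sub.B R) (_ : Q.Restricts f g')
      (z z'), P.proj.dR.baseChange R z = Q.proj.dR.baseChange R z' ↔
        P.proj.B.baseChange R (g z) = Q.proj.B.baseChange R (g' z') := by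
    intro Q g' hg' z z'
    have h := hg.baseChange_eq_iff hf hg' (𝟙 X) z z'
    change (LinearMap.id (R := k) (M := X.dR)).baseChange R _ = _ ↔
      (LinearMap.id (R := k) (M := X.B)).baseChange R _ = _ at h
    simpa only [LinearMap.baseChange_id, LinearMap.id_apply] using h
  -- Comparing `P` with itself at `z' = 0` identifies the two kernels.
  obtain ⟨h, hh⟩ := exists_descend g P.proj_dR P.proj_B fun z => by
    simpa only [map_zero] using key P g hg z 0
  refine ⟨h, fun Q g' hg' => Compat.of_apply fun z' => ?_⟩
  obtain ⟨z, hz⟩ := baseChange_surjective (R := R) P.proj_dR (Q.proj.dR.baseChange R z')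
  rw [← hz, hh.apply]
  exact (key Q g' hg' z z').mp hz

end Presentation

/-- The tensor isomorphism of fibre functors defined by an isomorphism which preserves
subobjects. -/
def toTensorIso (hf : PreservesSubobjects f) : TensorIso N R where
  app X hX := (Presentation.exists_compat_proj hf hX).choose
  naturality X Y hX hY h := by
    obtain ⟨P⟩ := nonempty_presentation hX
    obtain ⟨Q⟩ := nonempty_presentation hY
    obtain ⟨g, hg⟩ := P.exists_restricts hf
    obtain ⟨g', hg'⟩ := Q.exists_restricts hf
    have hP := (Presentation.exists_compat_proj hf hX).choose_spec P g hg
    have hQ := (Presentation.exists_compat_proj hf hY).choose_spec Q g' hg'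
    refine Compat.of_apply fun x => ?_
    obtain ⟨z, rfl⟩ := baseChange_surjective (R := R) P.proj_dR x
    obtain ⟨z', hz'⟩ := baseChange_surjective (R := R) Q.proj_dR
      (h.dR.baseChange R (P.proj.dR.baseChange R z))
    rw [← hz', hQ.apply, hP.apply]
    exact ((hg.baseChange_eq_iff hf hg' h z z').mp hz'.symm).symm
  tensor X Y hX hY hXY := by
    obtain ⟨P⟩ := nonempty_presentation hX
    obtain ⟨Q⟩ := nonempty_presentation hY
    obtain ⟨g, hg⟩ := P.exists_restricts hf
    obtain ⟨g', hg'⟩ := Q.exists_restricts hf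
    have hP := (Presentation.exists_compat_proj hf hX).choose_spec P g hg
    have hQ := (Presentation.exists_compat_proj hf hY).choose_spec Q g' hg'
    -- Over a field the tensor product of two presentations is a presentation of the tensor product,
    -- with `g.tensor g'` as its restriction.
    let T : Presentation N (X.tensor Y) :=
      { extension := P.extension.tensor Q.extension
        isTensorial := P.isTensorial.tensor Q.isTensorial
        sub := P.sub.tensor Q.sub
        incl := ⟨TensorProduct.map P.incl.dR Q.incl.dR, TensorProduct.map P.incl.B Q.incl.B,
          (Hom.compat P.incl).tensor (Hom.compat Q.incl)⟩
        proj := ⟨TensorProduct.map P.proj.dR Q.proj.dR, TensorProduct.map P.proj.B Q.proj.B,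
          (Hom.compat P.proj).tensor (Hom.compat Q.proj)⟩
        incl_dR := TensorProduct.map_injective_of_flat_flat _ _ P.incl_dR Q.incl_dR
        incl_B := TensorProduct.map_injective_of_flat_flat _ _ P.incl_B Q.incl_B
        proj_dR := TensorProduct.map_surjective P.proj_dR Q.proj_dR
        proj_B := TensorProduct.map_surjective P.proj_B Q.proj_B }
    have hT := (Presentation.exists_compat_proj hf hXY).choose_spec T (g.tensor g')
      (Compat.tensor hg hg')
    have hT' := hP.tensor hQ
    refine LinearEquiv.ext fun x => ?_
    obtain ⟨z, rfl⟩ := baseChange_surjective (R := R) T.proj_dR x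
    exact (hT.apply z).trans (hT'.apply z).symm
  unit h := by
    have := (Presentation.exists_compat_proj hf h).choose_spec
      (isTensorial_unit (N := N)).presentation (IsoPt.unit k k R) Compat.refl
    refine LinearEquiv.ext fun x => ?_
    have := this.apply x
    change (Presentation.exists_compat_proj hf h).choose
        ((LinearMap.id (R := k) (M := k)).baseChange R x) =
      (LinearMap.id (R := k) (M := k)).baseChange R (IsoPt.unit k k R x) at this
    rwa [LinearMap.baseChange_id, LinearMap.id_apply, LinearMap.id_apply] at this

theorem eval_toTensorIso (hf : PreservesSubobjects f) : (toTensorIso hf).eval = f := by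
  have := (Presentation.exists_compat_proj hf N.gen_self).choose_spec
    (isTensorial_self (N := N)).presentation f Compat.refl
  refine LinearEquiv.ext fun x => ?_
  have := this.apply x
  change (toTensorIso hf).eval ((LinearMap.id (R := k) (M := N.dR)).baseChange R x) =
    (LinearMap.id (R := k) (M := N.B)).baseChange R (f x) at this
  rwa [LinearMap.baseChange_id, LinearMap.baseChange_id, LinearMap.id_apply,
    LinearMap.id_apply] at this

/-! ### Tensor isomorphisms are determined by their value at `N` -/

/-- A tensor isomorphism of fibre functors takes the values prescribed by the extension. -/
def Computes (E : Extension N X) (t : TensorIso N R) : Prop :=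
  ∀ h : N.gen X, t.app X h = E.app t.eval

section

variable (t : TensorIso N R) {E : Extension N X} {F : Extension N Y}

theorem computes_self : (self N).Computes t :=
  fun _ => rfl

theorem computes_unit : (unit N).Computes t :=
  fun h => t.unit h

variable {t}

theorem Computes.tensor (hE : E.IsTensorial) (hF : F.IsTensorial) (h : E.Computes t)
    (h' : F.Computes t) : (E.tensor F).Computes t := fun hXY => by
  rw [t.tensor X Y hE.gen hF.gen hXY, h hE.gen, h' hF.gen]
  rfl

theorem Computes.prod (hE : E.IsTensorial) (hF : F.IsTensorial) (h : E.Computes t)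
    (h' : F.Computes t) : (E.prod F).Computes t := fun hXY => by
  have h1 : Compat (t.app X hE.gen) (t.app (X.prod Y) hXY) (LinearMap.inl k _ _)
      (LinearMap.inl k _ _) :=
    t.naturality X (X.prod Y) hE.gen hXY ⟨LinearMap.inl k _ _, LinearMap.inl k _ _, Compat.inl⟩
  have h2 : Compat (t.app Y hF.gen) (t.app (X.prod Y) hXY) (LinearMap.inr k _ _)
      (LinearMap.inr k _ _) :=
    t.naturality Y (X.prod Y) hF.gen hXY ⟨LinearMap.inr k _ _, LinearMap.inr k _ _, Compat.inr⟩
  rw [eq_prod_of_compat h1 h2, h hE.gen, h' hF.gen]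
  rfl

/-- Duals are not mentioned in `TensorIso`: the value comes from naturality for the evaluation
homomorphism from `N.dual.tensor N` to the unit object. -/
theorem computes_dual (t : TensorIso N R) : (self N).dual.Computes t := fun h => by
  have hT := (isTensorial_dual (N := N)).tensor isTensorial_self
  have h1 : Compat (t.app (N.dual.tensor N) hT.gen) (t.app _ isTensorial_unit.gen)
      (contractLeft k N.dR) (contractLeft k N.B) :=
    t.naturality (N.dual.tensor N) (Obj.unit k k) hT.gen isTensorial_unit.gen
      ⟨contractLeft k N.dR, contractLeft k N.B, Compat.contractLeft⟩
  rw [t.unit, t.tensor N.dual N h N.gen_self] at h1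
  exact eq_dual_of_compat h1

theorem Computes.tensorPow (hE : ∀ n, (E.tensorPow n).IsTensorial) (hE' : E.IsTensorial)
    (h : E.Computes t) : ∀ n, (E.tensorPow n).Computes t
  | 0 => computes_unit t
  | n + 1 => (h.tensorPow hE hE' n).tensor (hE n) hE' h

theorem computes_tensorSpace (t : TensorIso N R) : ∀ l, (tensorSpace N l).Computes t
  | [] => fun _ => LinearEquiv.ext fun _ => Subsingleton.elim (α := R ⊗[k] PUnit) _ _
  | p :: l => Computes.prod (isTensorial_tensorPow_tensor p.1 p.2) (isTensorial_tensorSpace l)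
      (((computes_self t).tensorPow isTensorial_tensorPow isTensorial_self p.1).tensor
        (isTensorial_tensorPow _) (isTensorial_dual_tensorPow _)
        ((computes_dual t).tensorPow isTensorial_dual_tensorPow isTensorial_dual p.2))
      (computes_tensorSpace t l)

end

theorem gen_of_injective {l : List (ℕ × ℕ)} (i : S ⟶ N.tensorSpace l)
    (hi : Function.Injective i.dR) (hi' : Function.Injective i.B) : N.gen S :=
  ⟨l, S, i, 𝟙 S, ⟨hi, hi'⟩, Function.surjective_id, Function.surjective_id⟩

theorem compat_app_of_injective (t : TensorIso N R) {l : List (ℕ × ℕ)} (i : S ⟶ N.tensorSpace l)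
    (hi : Function.Injective i.dR) (hi' : Function.Injective i.B) :
    Compat (t.app S (gen_of_injective i hi hi')) ((tensorSpace N l).app t.eval) i.dR i.B := by
  rw [← computes_tensorSpace t l (isTensorial_tensorSpace l).gen]
  exact t.naturality _ _ _ _ i

theorem preservesSubobjects_eval (t : TensorIso N R) : PreservesSubobjects t.eval :=
  fun _ _ i hi hi' => ⟨_, compat_app_of_injective t i hi hi'⟩

/-- This replaces the Tannakian definition by a concrete condition on subobjects, on which
closedness, the heap law and minimality all rest. -/
theorem mem_torsorOfPeriods_iff (f : IsoPt k k N.dR N.B R) :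
    f ∈ torsorOfPeriods N R ↔ PreservesSubobjects f := by
  constructor
  · rintro ⟨t, rfl⟩
    exact preservesSubobjects_eval t
  · exact fun hf => ⟨toTensorIso hf, eval_toTensorIso hf⟩

/-- Equal values at `N` give equal values on tensor spaces, then on a subobject because its
inclusion stays injective over `R`, then on a quotient of it because the projection stays
surjective. -/
theorem eval_injective : Function.Injective (fun t : TensorIso N R => t.eval) := by
  intro t t' h
  change t.eval = t'.eval at h
  ext X hX x
  obtain ⟨l, S, i, p, ⟨h1, h2⟩, h3, h4⟩ := id hX
  have hS := gen_of_injective i h1 h2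
  have e : ∀ z, t.app S hS z = t'.app S hS z := fun z => by
    apply baseChange_injective h2
    rw [← (compat_app_of_injective t i h1 h2).apply, ← (compat_app_of_injective t' i h1 h2).apply,
      h]
  obtain ⟨z, hz⟩ := baseChange_surjective (R := R) h3 x
  have hp : Compat (t.app S hS) (t.app X hX) p.dR p.B := t.naturality S X hS hX p
  have hp' : Compat (t'.app S hS) (t'.app X hX) p.dR p.B := t'.naturality S X hS hX p
  have := hp.apply z
  rw [e, ← hp'.apply, hz] at this
  exact this

end Extension

/-! ### Linear forms after extension of scalars -/

section Functional

variable {k R S V W V₁ : Type} [Field k] [CommRing R] [Algebra k R] [CommRing S] [Algebra k S]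
  [AddCommGroup V] [Module k V] [AddCommGroup W] [Module k W] [AddCommGroup V₁] [Module k V₁]

/-- The `R`-linear form on `R ⊗ V` defined by a linear form on `V`. -/
def evalDual (R : Type) [CommRing R] [Algebra k R] (l : Module.Dual k V) : R ⊗[k] V →ₗ[R] R :=
  (TensorProduct.AlgebraTensorModule.rid k R R).toLinearMap ∘ₗ LinearMap.baseChange R l

@[simp]
theorem evalDual_tmul (l : Module.Dual k V) (r : R) (v : V) :
    evalDual R l (r ⊗ₜ v) = l v • r := by
  simp [evalDual]

theorem map_evalDual (φ : R →ₐ[k] S) (l : Module.Dual k V) (x : R ⊗[k] V) :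
    φ (evalDual R l x) = evalDual S l (φ.toLinearMap.rTensor V x) := by
  induction x with
  | zero => simp
  | add x y hx hy => simp only [map_add, hx, hy]
  | tmul r v => simp

theorem evalDual_baseChange (l : Module.Dual k W) (a : V →ₗ[k] W) (x : R ⊗[k] V) :
    evalDual R l (a.baseChange R x) = evalDual R (l ∘ₗ a) x := by
  simp only [evalDual, LinearMap.baseChange_comp, LinearMap.comp_apply]

theorem evalDual_box (l : Module.Dual k V) (m : Module.Dual k W) (x : R ⊗[k] V) (y : R ⊗[k] W) :
    evalDual R (TensorProduct.lid k k ∘ₗ TensorProduct.map l m) (IsoPt.box x y) =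
      evalDual R l x * evalDual R m y := by
  induction x with
  | zero => simp
  | add x x' hx hx' => simp only [map_add, LinearMap.add_apply, hx, hx', add_mul]
  | tmul r v =>
    induction y with
    | zero => simp
    | add y y' hy hy' => simp only [map_add, hy, hy', mul_add]
    | tmul s w => simp [IsoPt.box_tmul, mul_smul_mul_comm]

theorem evalDual_eq_pairing [FiniteDimensional k V] (l : Module.Dual k V) (x : R ⊗[k] V) :
    evalDual R l x = IsoPt.pairing (1 ⊗ₜ l) x := by
  induction x with
  | zero => simp
  | add x y hx hy => simp only [map_add, hx, hy]
  | tmul r v => simp [Algebra.smul_def, mul_comm]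

theorem evalDual_dual_eval [FiniteDimensional k V] (v : V) (ξ : R ⊗[k] Module.Dual k V) :
    evalDual R (Module.Dual.eval k V v) ξ = IsoPt.pairing ξ (1 ⊗ₜ v) := by
  induction ξ with
  | zero => simp
  | add x y hx hy => simp only [map_add, hx, hy, LinearMap.add_apply]
  | tmul r v => simp [Algebra.smul_def, mul_comm]

theorem basis_repr_eq_evalDual {ι : Type} (b : Module.Basis ι k V) (x : R ⊗[k] V) (i : ι) :
    (Algebra.TensorProduct.basis R b).repr x i = evalDual R (b.coord i) x := by
  induction x with
  | zero => simp
  | add x y hx hy => simp only [map_add, Finsupp.add_apply, hx, hy]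
  | tmul r v => simp [Algebra.smul_def, mul_comm]

/-- By exactness, it suffices that `x` vanishes in the base change of `W ⧸ range j`. Its coordinates
there are given by forms on `W` that kill `j`. -/
theorem mem_range_baseChange (j : V →ₗ[k] W) (x : R ⊗[k] W)
    (h : ∀ l : Module.Dual k W, l ∘ₗ j = 0 → evalDual R l x = 0) :
    x ∈ LinearMap.range (j.baseChange R) := by
  refine (Module.Flat.lTensor_exact (M := R) (LinearMap.exact_map_mkQ_range j) x).mp ?_
  change (LinearMap.range j).mkQ.baseChange R x = 0
  let b := Module.Basis.ofVectorSpace k (W ⧸ LinearMap.range j)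
  apply (Algebra.TensorProduct.basis R b).repr.injective
  ext i
  rw [basis_repr_eq_evalDual, evalDual_baseChange, h]
  · simp
  · ext v
    have : (LinearMap.range j).mkQ (j v) = 0 := by simp
    simp only [LinearMap.comp_apply, this, map_zero, LinearMap.zero_apply]

end Functional

/-! ### The coordinate ring of `Iso(V, W)` -/

section Coordinates

variable {k V W R S ι κ : Type} [Field k] [AddCommGroup V] [Module k V] [AddCommGroup W]
  [Module k W] [CommRing R] [Algebra k R] [CommRing S] [Algebra k S] [Fintype ι] [Fintype κ]
  (b : Module.Basis ι k V) (b' : Module.Basis κ k W)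

/-- The matrix entries of an isomorphism and of its inverse. -/
def isoEntries (f : IsoPt k k V W R) : κ × ι ⊕ ι × κ → R :=
  Sum.elim (fun p => evalDual R (b'.coord p.1) (f (1 ⊗ₜ b p.2)))
    (fun p => evalDual R (b.coord p.1) (f.symm (1 ⊗ₜ b' p.2)))

variable (k ι κ) in
/-- The matrix of indeterminates. -/
def coordMatrix : Matrix κ ι (MvPolynomial (κ × ι ⊕ ι × κ) k) :=
  Matrix.of fun j i => MvPolynomial.X (Sum.inl (j, i))

variable (k ι κ) in
/-- The matrix of the indeterminates for the entries of the inverse. -/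
def coordMatrixInv : Matrix ι κ (MvPolynomial (κ × ι ⊕ ι × κ) k) :=
  Matrix.of fun i j => MvPolynomial.X (Sum.inr (i, j))

theorem toMatrix_eq_isoEntries [DecidableEq ι] (f : IsoPt k k V W R) :
    LinearMap.toMatrix (Algebra.TensorProduct.basis R b) (Algebra.TensorProduct.basis R b')
      f.toLinearMap = (coordMatrix k ι κ).map (MvPolynomial.aeval (isoEntries b b' f)) := by
  ext j i
  simp [LinearMap.toMatrix_apply, basis_repr_eq_evalDual, isoEntries, coordMatrix]

theorem toMatrix_symm_eq_isoEntries [DecidableEq κ] (f : IsoPt k k V W R) :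
    LinearMap.toMatrix (Algebra.TensorProduct.basis R b') (Algebra.TensorProduct.basis R b)
      f.symm.toLinearMap =
        (coordMatrixInv k ι κ).map (MvPolynomial.aeval (isoEntries b b' f)) := by
  ext j i
  simp [LinearMap.toMatrix_apply, basis_repr_eq_evalDual, isoEntries, coordMatrixInv]

variable [DecidableEq ι] [DecidableEq κ]

variable (k ι κ) in
/-- The relations between the matrix entries of an isomorphism and of its inverse. -/
def isoRelations : Ideal (MvPolynomial (κ × ι ⊕ ι × κ) k) :=
  Ideal.span
    (Set.range (fun p : κ × κ =>
        (coordMatrix k ι κ * coordMatrixInv k ι κ - 1 : Matrix κ κ _) p.1 p.2) ∪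
      Set.range (fun p : ι × ι =>
        (coordMatrixInv k ι κ * coordMatrix k ι κ - 1 : Matrix ι ι _) p.1 p.2))

variable (k ι κ) in
/-- The coordinate ring of `Iso(V, W)`. -/
abbrev IsoRing : Type := MvPolynomial (κ × ι ⊕ ι × κ) k ⧸ isoRelations k ι κ

variable (k ι κ) in
/-- The universal matrix. -/
def univMatrix : Matrix κ ι (IsoRing k ι κ) :=
  (coordMatrix k ι κ).map (Ideal.Quotient.mk _)

variable (k ι κ) in
/-- The inverse of the universal matrix. -/
def univMatrixInv : Matrix ι κ (IsoRing k ι κ) :=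
  (coordMatrixInv k ι κ).map (Ideal.Quotient.mk _)

theorem univMatrix_mul_univMatrixInv : univMatrix k ι κ * univMatrixInv k ι κ = 1 := by
  rw [univMatrix, univMatrixInv, ← Matrix.map_mul, ← sub_eq_zero,
    ← Matrix.map_one (Ideal.Quotient.mk (isoRelations k ι κ)) (map_zero _) (map_one _),
    ← Matrix.map_sub _ (map_sub _)]
  ext i j
  exact Ideal.Quotient.eq_zero_iff_mem.mpr (Ideal.subset_span (Or.inl ⟨(i, j), rfl⟩))

theorem univMatrixInv_mul_univMatrix : univMatrixInv k ι κ * univMatrix k ι κ = 1 := by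
  rw [univMatrix, univMatrixInv, ← Matrix.map_mul, ← sub_eq_zero,
    ← Matrix.map_one (Ideal.Quotient.mk (isoRelations k ι κ)) (map_zero _) (map_one _),
    ← Matrix.map_sub _ (map_sub _)]
  ext i j
  exact Ideal.Quotient.eq_zero_iff_mem.mpr (Ideal.subset_span (Or.inr ⟨(i, j), rfl⟩))

/-- The universal isomorphism. -/
def univIso : IsoPt k k V W (IsoRing k ι κ) :=
  LinearEquiv.ofLinearMap
    (Matrix.toLin (Algebra.TensorProduct.basis _ b) (Algebra.TensorProduct.basis _ b')
      (univMatrix k ι κ))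
    (Matrix.toLin (Algebra.TensorProduct.basis _ b') (Algebra.TensorProduct.basis _ b)
      (univMatrixInv k ι κ))
    (by rw [← Matrix.toLin_mul, univMatrix_mul_univMatrixInv, Matrix.toLin_one])
    (by rw [← Matrix.toLin_mul, univMatrixInv_mul_univMatrix, Matrix.toLin_one])

theorem univIso_apply (i : ι) : univIso b b' (1 ⊗ₜ b i) = ∑ j, univMatrix k ι κ j i ⊗ₜ b' j := by
  have h := Matrix.toLin_self (Algebra.TensorProduct.basis (IsoRing k ι κ) b)
    (Algebra.TensorProduct.basis (IsoRing k ι κ) b') (univMatrix k ι κ) i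
  simp only [Algebra.TensorProduct.basis_apply, TensorProduct.smul_tmul', smul_eq_mul,
    mul_one] at h
  exact h

theorem aeval_isoEntries_eq_zero (f : IsoPt k k V W R) (P : MvPolynomial (κ × ι ⊕ ι × κ) k)
    (hP : P ∈ isoRelations k ι κ) : MvPolynomial.aeval (isoEntries b b' f) P = 0 := by
  suffices isoRelations k ι κ ≤
      RingHom.ker (MvPolynomial.aeval (R := k) (isoEntries b b' f)) from this hP
  refine Ideal.span_le.mpr (Set.union_subset ?_ ?_)
  · rintro _ ⟨⟨i, j⟩, rfl⟩
    have h := LinearMap.toMatrix_comp (Algebra.TensorProduct.basis R b')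
      (Algebra.TensorProduct.basis R b) (Algebra.TensorProduct.basis R b') f.toLinearMap
      f.symm.toLinearMap
    rw [toMatrix_eq_isoEntries, toMatrix_symm_eq_isoEntries, LinearEquiv.comp_symm,
      LinearMap.toMatrix_id, ← Matrix.map_mul, ← Matrix.map_one
      (MvPolynomial.aeval (R := k) (isoEntries b b' f)) (map_zero _) (map_one _), eq_comm,
      ← sub_eq_zero, ← Matrix.map_sub _ (map_sub _)] at h
    exact congrFun (congrFun h i) j
  · rintro _ ⟨⟨i, j⟩, rfl⟩
    have h := LinearMap.toMatrix_comp (Algebra.TensorProduct.basis R b)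
      (Algebra.TensorProduct.basis R b') (Algebra.TensorProduct.basis R b) f.symm.toLinearMap
      f.toLinearMap
    rw [toMatrix_symm_eq_isoEntries, toMatrix_eq_isoEntries, LinearEquiv.symm_comp,
      LinearMap.toMatrix_id, ← Matrix.map_mul, ← Matrix.map_one
      (MvPolynomial.aeval (R := k) (isoEntries b b' f)) (map_zero _) (map_one _), eq_comm,
      ← sub_eq_zero, ← Matrix.map_sub _ (map_sub _)] at h
    exact congrFun (congrFun h i) j

/-- The homomorphism from the coordinate ring which classifies an isomorphism. -/
def classify (f : IsoPt k k V W R) : IsoRing k ι κ →ₐ[k] R :=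
  Ideal.Quotient.liftₐ _ (MvPolynomial.aeval (isoEntries b b' f))
    (aeval_isoEntries_eq_zero b b' f)

theorem classify_mk (f : IsoPt k k V W R) (P : MvPolynomial (κ × ι ⊕ ι × κ) k) :
    classify b b' f (Ideal.Quotient.mk _ P) = MvPolynomial.aeval (isoEntries b b' f) P :=
  rfl

/-- Every point is a specialisation of the universal one: this is the half of representability that
the proof needs. -/
theorem map_classify (f : IsoPt k k V W R) : (univIso b b').map (classify b b' f) = f := by
  apply LinearEquiv.toLinearMap_injective
  refine (Algebra.TensorProduct.basis R b).ext fun i => ?_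
  have h := IsoPt.map_rTensor (classify b b' f) (univIso b b') (1 ⊗ₜ b i)
  rw [univIso_apply, map_sum, LinearMap.rTensor_tmul, AlgHom.toLinearMap_apply, map_one] at h
  rw [Algebra.TensorProduct.basis_apply, LinearEquiv.coe_coe, LinearEquiv.coe_coe, h,
    ← (Algebra.TensorProduct.basis R b').sum_repr (f (1 ⊗ₜ b i))]
  refine Finset.sum_congr rfl fun j _ => ?_
  rw [basis_repr_eq_evalDual, Algebra.TensorProduct.basis_apply, LinearMap.rTensor_tmul,
    TensorProduct.smul_tmul', smul_eq_mul, mul_one, univMatrix, AlgHom.toLinearMap_apply,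
    Matrix.map_apply, coordMatrix, Matrix.of_apply, classify_mk, MvPolynomial.aeval_X]
  rfl

/-- Yoneda: by naturality `φ` is determined by its value at the universal isomorphism, and `P` is
any polynomial lifting that value. -/
theorem RegularFunction.exists_aeval (φ : RegularFunction k V W) :
    ∃ P : MvPolynomial (κ × ι ⊕ ι × κ) k, ∀ (R : Type) [CommRing R] [Algebra k R]
      (f : IsoPt k k V W R), φ.toFun R f = MvPolynomial.aeval (isoEntries b b' f) P := by
  obtain ⟨P, hP⟩ := Ideal.Quotient.mk_surjective (φ.toFun _ (univIso b b'))
  refine ⟨P, fun R _ _ f => ?_⟩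
  rw [← classify_mk, hP, ← φ.natural, map_classify]

end Coordinates

/-! ### Closed subschemes with a complex point -/

/-- Nullstellensatz: a residue field of `A` is finite over `k`, hence embeds in `k`. -/
theorem nonempty_algHom_of_finiteType {k : Type} [Field k] [IsAlgClosed k] (A : Type)
    [CommRing A] [Nontrivial A]
    [Algebra k A] [Algebra.FiniteType k A] : Nonempty (A →ₐ[k] k) := by
  obtain ⟨m, hm⟩ := Ideal.exists_maximal A
  let _ : Field (A ⧸ m) := Ideal.Quotient.field m
  have : Module.Finite k (A ⧸ m) := finite_of_finite_type_of_isJacobsonRing _ _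
  exact ⟨(IsAlgClosed.lift : (A ⧸ m) →ₐ[k] k).comp (Ideal.Quotient.mkₐ k m)⟩

section Closed

variable {k V W : Type} [Field k] [AddCommGroup V] [Module k V] [AddCommGroup W] [Module k W]
  {T : PointFamily k V W}

theorem PointFamily.IsClosedSubscheme.map_mem (hT : T.IsClosedSubscheme) {R S : Type}
    [CommRing R] [Algebra k R] [CommRing S] [Algebra k S] (φ : R →ₐ[k] S)
    {f : IsoPt k k V W R} (hf : f ∈ T R) : f.map φ ∈ T S := by
  obtain ⟨I, hI⟩ := hT
  rw [hI] at hf ⊢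
  intro ψ hψ
  rw [ψ.natural, hf ψ hψ, map_zero]

theorem PointFamily.IsClosedSubscheme.mem_of_map (hT : T.IsClosedSubscheme) {R S : Type}
    [CommRing R] [Algebra k R] [CommRing S] [Algebra k S] (φ : R →ₐ[k] S)
    (hφ : Function.Injective φ) {f : IsoPt k k V W R} (hf : f.map φ ∈ T S) : f ∈ T R := by
  obtain ⟨I, hI⟩ := hT
  rw [hI] at hf ⊢
  intro ψ hψ
  apply hφ
  rw [← ψ.natural, hf ψ hψ, map_zero]

/-- Over an algebraically closed field, a closed subscheme of `Iso(V, W)` with a point in a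
nonzero ring has a rational point. -/
theorem PointFamily.IsClosedSubscheme.exists_rational [IsAlgClosed k] [FiniteDimensional k V]
    [FiniteDimensional k W] (hT : T.IsClosedSubscheme) {R : Type} [CommRing R] [Nontrivial R]
    [Algebra k R] {c : IsoPt k k V W R} (hc : c ∈ T R) : ∃ t : IsoPt k k V W k, t ∈ T k := by
  let b := Module.finBasis k V
  let b' := Module.finBasis k W
  -- `R` need not be of finite type, but the point is defined over the image of the coordinate ring
  -- in `R`, which is.
  let χ := classify b b' c
  have h1 : (univIso b b').map χ.rangeRestrict ∈ T χ.range := by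
    refine hT.mem_of_map χ.range.val Subtype.val_injective ?_
    rw [IsoPt.map_map]
    change (univIso b b').map χ ∈ T R
    rwa [map_classify]
  have : Algebra.FiniteType k χ.range :=
    Algebra.FiniteType.of_surjective χ.rangeRestrict χ.rangeRestrict_surjective
  obtain ⟨ψ⟩ := nonempty_algHom_of_finiteType (k := k) χ.range
  exact ⟨_, hT.map_mem ψ h1⟩

/-- The base change of a rational point. -/
def IsoPt.const (R : Type) [CommRing R] [Algebra k R] (t : IsoPt k k V W k) :
    IsoPt k k V W R :=
  t.map (Algebra.ofId k R)

theorem IsoPt.map_const {R S : Type} [CommRing R] [Algebra k R] [CommRing S] [Algebra k S]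
    (φ : R →ₐ[k] S) (t : IsoPt k k V W k) : (t.const R).map φ = t.const S := by
  rw [const, map_map]
  congr 1
  exact Subsingleton.elim _ _

/-- A family of points which is stable under the ternary operation `(f, g, h) ↦ h ∘ g⁻¹ ∘ f`. -/
def PointFamily.IsHeap (T : PointFamily k V W) : Prop :=
  ∀ (R : Type) [CommRing R] [Algebra k R] (f g h : IsoPt k k V W R),
    f ∈ T R → g ∈ T R → h ∈ T R → (f ≪≫ₗ g.symm ≪≫ₗ h : IsoPt k k V W R) ∈ T R

theorem IsSubtorsor.isHeap (hT : IsSubtorsor T) : T.IsHeap := by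
  obtain ⟨-, G, -, hG⟩ := hT
  exact fun R _ _ f g h hf hg hh => hG.smul_mem R _ _ (hG.div_mem R g h hg hh) hf

/-- The group is the translate of `T` by `t⁻¹`, closed over `k` because `t` is rational. Its group
laws and the torsor property are instances of the heap law with `t` inserted. -/
theorem isSubtorsor_of_isHeap (hT : T.IsClosedSubscheme) (hT' : T.IsHeap)
    {t : IsoPt k k V W k} (ht : t ∈ T k) : IsSubtorsor T := by
  have htR : ∀ (R : Type) [CommRing R] [Algebra k R], t.const R ∈ T R := fun R _ _ =>
    hT.map_mem _ ht
  refine ⟨hT, fun R _ _ => {g | (t.const R ≪≫ₗ g : IsoPt k k V W R) ∈ T R}, ?_, ?_⟩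
  · constructor
    · obtain ⟨I, hI⟩ := hT
      refine ⟨Set.range fun φ : I =>
        ⟨fun R _ _ g => φ.1.toFun R (t.const R ≪≫ₗ g), fun R S _ _ _ _ ψ g => ?_⟩, ?_⟩
      · rw [← φ.1.natural, IsoPt.map_trans, IsoPt.map_const]
      · intro R _ _ f
        rw [Set.mem_ofPred_eq, hI, Set.forall_mem_range]
        exact ⟨fun h φ => h φ.1 φ.2, fun h φ hφ => h ⟨φ, hφ⟩⟩
    · intro R _ _
      exact htR R
    · intro R _ _ g h hg hh
      have := hT' R _ _ _ hh (htR R) hg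
      have e : (t.const R ≪≫ₗ (g * h) : IsoPt k k V W R) =
          (t.const R ≪≫ₗ h) ≪≫ₗ (t.const R).symm ≪≫ₗ (t.const R ≪≫ₗ g) := by
        ext x
        simp
      change (t.const R ≪≫ₗ (g * h) : IsoPt k k V W R) ∈ T R
      rwa [e]
    · intro R _ _ g hg
      have := hT' R _ _ _ (htR R) hg (htR R)
      have e : (t.const R ≪≫ₗ g⁻¹ : IsoPt k k V W R) =
          t.const R ≪≫ₗ LinearEquiv.symm (t.const R ≪≫ₗ g) ≪≫ₗ t.const R := by
        ext x
        simp
      change (t.const R ≪≫ₗ g⁻¹ : IsoPt k k V W R) ∈ T R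
      rwa [e]
  · constructor
    · intro R _ _ g s hg hs
      have := hT' R _ _ _ hs (htR R) hg
      have e : (s ≪≫ₗ (t.const R).symm ≪≫ₗ (t.const R ≪≫ₗ g) : IsoPt k k V W R) = s ≪≫ₗ g := by
        ext x
        simp
      rwa [e] at this
    · intro R _ _ s s' hs hs'
      exact hT' R _ _ _ (htR R) hs hs'
    · exact ⟨k, _, _, inferInstance, t, ht⟩

end Closed

/-! ### Linear forms transported by an isomorphism -/

section Functional

variable {k R S V W : Type} [Field k] [CommRing R] [Algebra k R] [CommRing S] [Algebra k S]
  [AddCommGroup V] [Module k V] [AddCommGroup W] [Module k W]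

theorem evalDual_add (l m : Module.Dual k V) (x : R ⊗[k] V) :
    evalDual R (l + m) x = evalDual R l x + evalDual R m x := by
  rw [evalDual, evalDual, evalDual, LinearMap.baseChange_add]
  simp only [LinearMap.comp_apply, LinearMap.add_apply, map_add]

theorem evalDual_smul (a : k) (l : Module.Dual k V) (x : R ⊗[k] V) :
    evalDual R (a • l) x = a • evalDual R l x := by
  induction x with
  | zero => simp
  | add x y hx hy => simp only [map_add, hx, hy, smul_add]
  | tmul r v => simp [mul_smul]

theorem evalDual_zero (x : R ⊗[k] V) : evalDual R (0 : Module.Dual k V) x = 0 := by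
  simpa using evalDual_smul 0 (0 : Module.Dual k V) x

theorem evalDual_lid (l : Module.Dual k V) (x : k ⊗[k] V) :
    evalDual k l x = l (TensorProduct.lid k V x) := by
  induction x with
  | zero => simp
  | add x y hx hy => simp only [map_add, hx, hy]
  | tmul r v => simp [mul_comm]

theorem rTensor_ofId (x : k ⊗[k] V) :
    (Algebra.ofId k R).toLinearMap.rTensor V x = 1 ⊗ₜ TensorProduct.lid k V x := by
  induction x with
  | zero => simp
  | add x y hx hy => simp only [map_add, hx, hy, TensorProduct.tmul_add]
  | tmul r v =>
    rw [LinearMap.rTensor_tmul, TensorProduct.lid_tmul, TensorProduct.tmul_smul,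
      TensorProduct.smul_tmul', AlgHom.toLinearMap_apply, Algebra.ofId_apply,
      Algebra.algebraMap_eq_smul_one]

/-- The linear form `w ↦ l (g (1 ⊗ w))` with values in `R`. -/
def transportedForm (g : IsoPt k k V W R) (l : Module.Dual k W) : V →ₗ[k] R :=
  (evalDual R l ∘ₗ g.toLinearMap).restrictScalars k ∘ₗ TensorProduct.mk k R V 1

theorem transportedForm_apply (g : IsoPt k k V W R) (l : Module.Dual k W) (v : V) :
    transportedForm g l v = evalDual R l (g (1 ⊗ₜ v)) :=
  rfl

/-- A functional `α` on `R` turns the `R`-valued form into a form over `k`. Evaluating that form on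
an `S`-point amounts to computing over `R ⊗ S` and then contracting `R` by `α`. -/
theorem evalDual_comp_transportedForm (g : IsoPt k k V W R) (l : Module.Dual k W)
    (α : Module.Dual k R) (y : S ⊗[k] V) :
    evalDual S (α ∘ₗ transportedForm g l) y =
      TensorProduct.lid k S (α.rTensor S (evalDual (R ⊗[k] S) l
        (g.map (Algebra.TensorProduct.includeLeft : R →ₐ[k] R ⊗[k] S)
          ((Algebra.TensorProduct.includeRight : S →ₐ[k] R ⊗[k] S).toLinearMap.rTensor V y)))) := by
  induction y with
  | zero => simp
  | add x y hx hy => simp only [map_add, hx, hy]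
  | tmul s v =>
    have h1 : (Algebra.TensorProduct.includeRight : S →ₐ[k] R ⊗[k] S).toLinearMap.rTensor V
        (s ⊗ₜ v) = ((1 : R) ⊗ₜ[k] s) •
          (Algebra.TensorProduct.includeLeft : R →ₐ[k] R ⊗[k] S).toLinearMap.rTensor V
            (1 ⊗ₜ v) := by
      rw [LinearMap.rTensor_tmul, LinearMap.rTensor_tmul, TensorProduct.smul_tmul',
        AlgHom.toLinearMap_apply, AlgHom.toLinearMap_apply, map_one, smul_eq_mul, mul_one,
        Algebra.TensorProduct.includeRight_apply]
    rw [h1, map_smul, map_smul, IsoPt.map_rTensor, ← map_evalDual, evalDual_tmul]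
    simp [transportedForm_apply]

end Functional

open IsoPt

variable {k : Type} [Field k] [Algebra k ℂ]

/-! ### Matrix coefficients and the equations of the torsor of periods -/

namespace Extension

variable {N X Y : Obj k k}

theorem app_map_tmul (E : Extension N X) {R S : Type} [CommRing R] [Algebra k R] [CommRing S]
    [Algebra k S] (φ : R →ₐ[k] S) (f : IsoPt k k N.dR N.B R) (v : X.dR) :
    E.app (f.map φ) (1 ⊗ₜ v) = φ.toLinearMap.rTensor X.B (E.app f (1 ⊗ₜ v)) := by
  rw [← E.map_app, ← map_rTensor, LinearMap.rTensor_tmul, AlgHom.toLinearMap_apply, map_one]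

theorem app_map_symm_tmul (E : Extension N X) {R S : Type} [CommRing R] [Algebra k R]
    [CommRing S] [Algebra k S] (φ : R →ₐ[k] S) (f : IsoPt k k N.dR N.B R) (w : X.B) :
    (E.app (f.map φ)).symm (1 ⊗ₜ w) =
      φ.toLinearMap.rTensor X.dR ((E.app f).symm (1 ⊗ₜ w)) := by
  rw [← E.map_app, ← map_symm]
  have := map_rTensor φ (E.app f).symm (1 ⊗ₜ w)
  rwa [LinearMap.rTensor_tmul, AlgHom.toLinearMap_apply, map_one] at this

/-- A matrix coefficient of an extension. -/
def coeff (E : Extension N X) (v : X.dR) (l : Module.Dual k X.B) :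
    RegularFunction k N.dR N.B where
  toFun R _ _ f := evalDual R l (E.app f (1 ⊗ₜ v))
  natural R S _ _ _ _ φ f := by rw [app_map_tmul, map_evalDual]

/-- A matrix coefficient of the inverse of an extension. -/
def coeffInv (E : Extension N X) (w : X.B) (l : Module.Dual k X.dR) :
    RegularFunction k N.dR N.B where
  toFun R _ _ f := evalDual R l ((E.app f).symm (1 ⊗ₜ w))
  natural R S _ _ _ _ φ f := by rw [app_map_symm_tmul, map_evalDual]

/-- Constants are coefficients of the unit object, sums of direct sums, and products of tensor
products. The entries of `f` come from `N`, those of `f⁻¹` from the dual of `N`. -/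
theorem exists_coeff_eq_aeval {ι κ : Type} [Fintype ι] [Fintype κ]
    (b : Module.Basis ι k N.dR) (b' : Module.Basis κ k N.B)
    (P : MvPolynomial (κ × ι ⊕ ι × κ) k) :
    ∃ (X : Obj k k) (E : Extension N X), E.IsTensorial ∧ ∃ (v : X.dR) (l : Module.Dual k X.B),
      ∀ (R : Type) [CommRing R] [Algebra k R] (f : IsoPt k k N.dR N.B R),
        MvPolynomial.aeval (isoEntries b b' f) P = (E.coeff v l).toFun R f := by
  induction P using MvPolynomial.induction_on with
  | C a =>
    refine ⟨_, unit N, isTensorial_unit, a, LinearMap.id, fun R _ _ f => ?_⟩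
    change _ = evalDual R LinearMap.id (IsoPt.unit k k R (1 ⊗ₜ a))
    rw [unit_eq_refl, LinearEquiv.refl_apply, evalDual_tmul, MvPolynomial.aeval_C,
      LinearMap.id_apply, Algebra.algebraMap_eq_smul_one]
  | add P Q hP hQ =>
    obtain ⟨X, E, hE, v, l, h⟩ := hP
    obtain ⟨Y, F, hF, w, m, h'⟩ := hQ
    refine ⟨_, E.prod F, hE.prod hF, (v, w), l.coprod m, fun R _ _ f => ?_⟩
    have e : (1 : R) ⊗ₜ[k] (v, w) = (LinearMap.inl k X.dR Y.dR).baseChange R (1 ⊗ₜ v) +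
        (LinearMap.inr k X.dR Y.dR).baseChange R (1 ⊗ₜ w) := by
      rw [LinearMap.baseChange_tmul, LinearMap.baseChange_tmul, ← TensorProduct.tmul_add]
      simp
    rw [map_add, h, h']
    change _ = evalDual R (l.coprod m) ((E.app f).prod (F.app f) (1 ⊗ₜ (v, w)))
    rw [e, map_add, Compat.inl.apply, Compat.inr.apply, map_add, evalDual_baseChange,
      evalDual_baseChange, LinearMap.coprod_inl, LinearMap.coprod_inr]
    rfl
  | mul_X P p hP =>
    obtain ⟨X, E, hE, v, l, h⟩ := hP
    suffices ∃ (Y : Obj k k) (F : Extension N Y), F.IsTensorial ∧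
        ∃ (w : Y.dR) (m : Module.Dual k Y.B), ∀ (R : Type) [CommRing R] [Algebra k R]
          (f : IsoPt k k N.dR N.B R), isoEntries b b' f p = (F.coeff w m).toFun R f by
      obtain ⟨Y, F, hF, w, m, h'⟩ := this
      refine ⟨_, E.tensor F, hE.tensor hF, v ⊗ₜ w,
        TensorProduct.lid k k ∘ₗ TensorProduct.map l m, fun R _ _ f => ?_⟩
      rw [map_mul, MvPolynomial.aeval_X, h, h']
      change _ = evalDual R (TensorProduct.lid k k ∘ₗ TensorProduct.map l m)
        ((E.app f).tensor (F.app f) (1 ⊗ₜ (v ⊗ₜ w)))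
      have e : (1 : R) ⊗ₜ[k] (v ⊗ₜ[k] w) = box (1 ⊗ₜ v) (1 ⊗ₜ w) := by rw [box_tmul, mul_one]
      rw [e, tensor_box, evalDual_box]
      rfl
    obtain ⟨j, i⟩ | ⟨i, j⟩ := p
    · exact ⟨N, self N, isTensorial_self, b i, b'.coord j, fun R _ _ f => rfl⟩
    · refine ⟨_, (self N).dual, isTensorial_dual, b.coord i, Module.Dual.eval k N.B (b' j),
        fun R _ _ f => ?_⟩
      change evalDual R (b.coord i) (f.symm (1 ⊗ₜ b' j)) =
        evalDual R (Module.Dual.eval k N.B (b' j)) (f.dual (1 ⊗ₜ b.coord i))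
      rw [evalDual_dual_eval, pairing_dual, evalDual_eq_pairing]

/-- Every regular function on `Iso(N_dR, N_B)` is a matrix coefficient of a tensor space. -/
theorem exists_coeff_eq (φ : RegularFunction k N.dR N.B) :
    ∃ (l : List (ℕ × ℕ)) (v : (N.tensorSpace l).dR) (m : Module.Dual k (N.tensorSpace l).B),
      ∀ (R : Type) [CommRing R] [Algebra k R] (f : IsoPt k k N.dR N.B R),
        φ.toFun R f = evalDual R m ((tensorSpace N l).app f (1 ⊗ₜ v)) := by
  obtain ⟨P, hP⟩ := φ.exists_aeval (Module.finBasis k N.dR) (Module.finBasis k N.B)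
  obtain ⟨X, E, ⟨l, a, b, hE⟩, v, m, h⟩ := exists_coeff_eq_aeval _ _ P
  refine ⟨l, a v, m ∘ₗ b.symm.toLinearMap, fun R _ _ f => ?_⟩
  have := (hE R f).symm.apply (1 ⊗ₜ a v)
  rw [← evalDual_baseChange, ← this, hP, h, LinearMap.baseChange_tmul]
  simp [coeff]

/-- Restriction means that `f` carries the de Rham subspace into the Betti subspace and `f⁻¹`
carries it back. Each inclusion is tested by the forms that vanish on the target subspace. -/
theorem preservesSubobjects_iff {R : Type} [CommRing R] [Algebra k R]
    (f : IsoPt k k N.dR N.B R) :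
    PreservesSubobjects f ↔
      ∀ (l : List (ℕ × ℕ)) (S : Obj k k) (i : S ⟶ N.tensorSpace l),
        Function.Injective i.dR → Function.Injective i.B →
          (∀ (v : S.dR) (m : Module.Dual k (N.tensorSpace l).B), m ∘ₗ i.B = 0 →
            ((tensorSpace N l).coeff (i.dR v) m).toFun R f = 0) ∧
          (∀ (w : S.B) (m : Module.Dual k (N.tensorSpace l).dR), m ∘ₗ i.dR = 0 →
            ((tensorSpace N l).coeffInv (i.B w) m).toFun R f = 0) := by
  constructor
  · intro hf l S i hi hi'
    obtain ⟨g, hg⟩ := hf l S i hi hi'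
    refine ⟨fun v m hm => ?_, fun w m hm => ?_⟩
    · have := hg.apply (1 ⊗ₜ v)
      rw [LinearMap.baseChange_tmul] at this
      change evalDual R m ((tensorSpace N l).app f (1 ⊗ₜ i.dR v)) = 0
      rw [this, evalDual_baseChange, hm, evalDual_zero]
    · have := hg.symm_apply (1 ⊗ₜ w)
      rw [LinearMap.baseChange_tmul] at this
      change evalDual R m (((tensorSpace N l).app f).symm (1 ⊗ₜ i.B w)) = 0
      rw [this, evalDual_baseChange, hm, evalDual_zero]
  · intro h l S i hi hi'
    obtain ⟨h1, h2⟩ := h l S i hi hi'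
    exact exists_restrict _ hi hi' (fun v => mem_range_baseChange _ _ (h1 v))
      (fun w => mem_range_baseChange _ _ (h2 w))

theorem isClosedSubscheme_torsorOfPeriods (N : Obj k k) :
    (torsorOfPeriods N).IsClosedSubscheme := by
  refine ⟨{φ | ∃ (l : List (ℕ × ℕ)) (S : Obj k k) (i : S ⟶ N.tensorSpace l),
    Function.Injective i.dR ∧ Function.Injective i.B ∧
      ((∃ (v : S.dR) (m : Module.Dual k (N.tensorSpace l).B), m ∘ₗ i.B = 0 ∧
        φ = (tensorSpace N l).coeff (i.dR v) m) ∨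
      (∃ (w : S.B) (m : Module.Dual k (N.tensorSpace l).dR), m ∘ₗ i.dR = 0 ∧
        φ = (tensorSpace N l).coeffInv (i.B w) m))}, fun R _ _ f => ?_⟩
  rw [mem_torsorOfPeriods_iff, preservesSubobjects_iff]
  constructor
  · rintro h φ ⟨l, S, i, hi, hi', ⟨v, m, hm, rfl⟩ | ⟨w, m, hm, rfl⟩⟩
    · exact (h l S i hi hi').1 v m hm
    · exact (h l S i hi hi').2 w m hm
  · exact fun h l S i hi hi' =>
      ⟨fun v m hm => h _ ⟨l, S, i, hi, hi', Or.inl ⟨v, m, hm, rfl⟩⟩,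
        fun w m hm => h _ ⟨l, S, i, hi, hi', Or.inr ⟨w, m, hm, rfl⟩⟩⟩

theorem isHeap_torsorOfPeriods (N : Obj k k) : (torsorOfPeriods N).IsHeap := by
  intro R _ _ f g h hf hg hh
  rw [mem_torsorOfPeriods_iff] at *
  intro l S i hi hi'
  obtain ⟨f', hf'⟩ := hf l S i hi hi'
  obtain ⟨g', hg'⟩ := hg l S i hi hi'
  obtain ⟨h', hh'⟩ := hh l S i hi hi'
  rw [Extension.heap]
  exact ⟨_, hf'.trans_iso (hg'.symm_iso.trans_iso hh')⟩

theorem c_mem_torsorOfPeriods (N : Obj k k) : N.c ∈ torsorOfPeriods N ℂ := by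
  rw [mem_torsorOfPeriods_iff]
  intro l S i _ _
  rw [Extension.app_c]
  exact ⟨S.c, Hom.compat i⟩

theorem isSubtorsor_torsorOfPeriods [IsAlgClosed k] (N : Obj k k) :
    IsSubtorsor (torsorOfPeriods N) := by
  obtain ⟨t, ht⟩ := (isClosedSubscheme_torsorOfPeriods N).exists_rational (c_mem_torsorOfPeriods N)
  exact isSubtorsor_of_isHeap (isClosedSubscheme_torsorOfPeriods N) (isHeap_torsorOfPeriods N) ht

/-! ### Minimality -/

section Minimal

variable (T : PointFamily k N.dR N.B) (E : Extension N X) (v : X.dR)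

/-- The linear forms which vanish on the orbit of a vector under a family of isomorphisms. -/
def orbitAnnihilator : Submodule k (Module.Dual k X.B) where
  carrier := {l | ∀ (R : Type) [CommRing R] [Algebra k R] (t : IsoPt k k N.dR N.B R), t ∈ T R →
    evalDual R l (E.app t (1 ⊗ₜ v)) = 0}
  add_mem' hl hm R _ _ t ht := by rw [evalDual_add, hl R t ht, hm R t ht, add_zero]
  zero_mem' R _ _ t _ := evalDual_zero _
  smul_mem' a l hl R _ _ t ht := by rw [evalDual_smul, hl R t ht, smul_zero]

/-- The span of the orbit of a vector under a family of isomorphisms. -/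
def orbitSpan : Submodule k X.B :=
  (orbitAnnihilator T E v).dualCoannihilator

variable {T v}

/-- Double annihilators in the dual of a finite-dimensional space. -/
theorem mem_orbitAnnihilator {l : Module.Dual k X.B}
    (h : l ∘ₗ (orbitSpan T E v).subtype = 0) : l ∈ orbitAnnihilator T E v := by
  rw [← Subspace.dualCoannihilator_dualAnnihilator_eq (W := orbitAnnihilator T E v),
    Submodule.mem_dualAnnihilator]
  exact fun s hs => LinearMap.congr_fun h ⟨s, hs⟩

variable (hT : T.IsClosedSubscheme) (hT' : T.IsHeap) {t₀ : IsoPt k k N.dR N.B k} (ht₀ : t₀ ∈ T k)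

-- On an orbit vector `h v` this is the heap law, since `t ∘ t₀⁻¹ ∘ h` again lies in `T`. The span
-- is defined by duality, so the law is applied to forms: for `l` killing the orbit and `α` a
-- functional on `R`, the form `s ↦ α (l (t (t₀⁻¹ s)))` kills every `S`-point of the orbit, by the
-- heap law over `R ⊗ S`.
include hT hT' ht₀ in
theorem app_symm_const_mem {R : Type} [CommRing R] [Algebra k R] {t : IsoPt k k N.dR N.B R}
    (ht : t ∈ T R) {s : X.B} (hs : s ∈ orbitSpan T E v) :
    E.app t ((E.app (t₀.const R)).symm (1 ⊗ₜ s)) ∈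
      LinearMap.range ((orbitSpan T E v).subtype.baseChange R) := by
  refine mem_range_baseChange _ _ fun l hl => ?_
  have hl := mem_orbitAnnihilator E hl
  let g : IsoPt k k X.B X.B R := (E.app (t₀.const R)).symm ≪≫ₗ E.app t
  change transportedForm g l s = 0
  refine (Module.forall_dual_apply_eq_zero_iff k _).mp fun α => ?_
  refine (Submodule.mem_dualCoannihilator _).mp hs (α ∘ₗ transportedForm g l) ?_
  intro S _ _ h hh
  have h1 := hl (R ⊗[k] S) _ (hT' _ _ _ _
    (hT.map_mem (Algebra.TensorProduct.includeRight : S →ₐ[k] R ⊗[k] S) hh)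
    (hT.map_mem (Algebra.ofId k (R ⊗[k] S)) ht₀)
    (hT.map_mem (Algebra.TensorProduct.includeLeft : R →ₐ[k] R ⊗[k] S) ht))
  rw [E.heap, LinearEquiv.trans_apply, LinearEquiv.trans_apply, app_map_tmul] at h1
  have hg : g.map (Algebra.TensorProduct.includeLeft : R →ₐ[k] R ⊗[k] S) =
      (E.app (t₀.const (R ⊗[k] S))).symm ≪≫ₗ
        E.app (t.map (Algebra.TensorProduct.includeLeft : R →ₐ[k] R ⊗[k] S)) := by
    rw [map_trans, map_symm, E.map_app, E.map_app, IsoPt.map_const]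
  rw [evalDual_comp_transportedForm, hg]
  exact (congrArg _ (congrArg _ h1)).trans (by rw [map_zero, map_zero])

/-- The isomorphism of vector spaces defined by a rational point. -/
def rationalEquiv (t₀ : IsoPt k k N.dR N.B k) : X.dR ≃ₗ[k] X.B :=
  (TensorProduct.lid k X.dR).symm ≪≫ₗ E.app t₀ ≪≫ₗ TensorProduct.lid k X.B

theorem app_const_tmul (t₀ : IsoPt k k N.dR N.B k) (R : Type) [CommRing R] [Algebra k R]
    (u : X.dR) : E.app (t₀.const R) (1 ⊗ₜ u) = 1 ⊗ₜ E.rationalEquiv t₀ u := by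
  rw [const, app_map_tmul, rTensor_ofId]
  rfl

theorem app_const_symm_tmul (t₀ : IsoPt k k N.dR N.B k) (R : Type) [CommRing R] [Algebra k R]
    (w : X.B) : (E.app (t₀.const R)).symm (1 ⊗ₜ w) = 1 ⊗ₜ (E.rationalEquiv t₀).symm w := by
  rw [LinearEquiv.symm_apply_eq, app_const_tmul, LinearEquiv.apply_symm_apply]

-- The orbit span is preserved by `c ∘ t₀⁻¹`, so `c` carries its preimage under `t₀` into it; the
-- inverse needs a separate argument with another point of `T`.
include hT hT' ht₀ in
theorem exists_orbit_comparison (hc : N.c ∈ T ℂ) :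
    ∃ c : IsoPt k k ((orbitSpan T E v).comap (E.rationalEquiv t₀).toLinearMap)
      (orbitSpan T E v) ℂ, Compat c X.c (Submodule.subtype _) (Submodule.subtype _) := by
  refine exists_restrict X.c (Submodule.injective_subtype _) (Submodule.injective_subtype _)
    (fun u => ?_) (fun s => ?_)
  · have := E.app_symm_const_mem hT hT' ht₀ hc (Submodule.mem_comap.mp u.2)
    rw [E.app_c] at this
    rwa [LinearEquiv.coe_coe, ← app_const_tmul, LinearEquiv.symm_apply_apply] at this
  · have ht := hT.map_mem (Algebra.ofId k ℂ) ht₀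
    -- The point `t₀ ∘ c⁻¹ ∘ t₀` of `T`, composed with `t₀⁻¹`, shows that `t₀ ∘ c⁻¹` preserves the
    -- span as well.
    obtain ⟨y, hy⟩ := E.app_symm_const_mem hT hT' ht₀ (hT' _ _ _ _ ht hc ht) s.2
    rw [E.heap, E.app_c] at hy
    change _ = E.app (t₀.const ℂ) (X.c.symm (E.app (t₀.const ℂ)
      ((E.app (t₀.const ℂ)).symm (1 ⊗ₜ (s : X.B))))) at hy
    rw [LinearEquiv.apply_symm_apply, ← LinearEquiv.symm_apply_eq] at hy
    change X.c.symm (1 ⊗ₜ (s : X.B)) ∈ _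
    rw [← hy]
    clear hy
    induction y with
    | zero => rw [map_zero, map_zero]; exact zero_mem _
    | add a b ha hb => rw [map_add, map_add]; exact add_mem ha hb
    | tmul r s =>
      have e : (orbitSpan T E v).subtype.baseChange ℂ (r ⊗ₜ s) =
          r • ((1 : ℂ) ⊗ₜ[k] (s : X.B)) := by
        rw [LinearMap.baseChange_tmul, TensorProduct.smul_tmul', smul_eq_mul, mul_one]
        rfl
      rw [e, map_smul, app_const_symm_tmul]
      refine Submodule.smul_mem _ _ ⟨1 ⊗ₜ ⟨(E.rationalEquiv t₀).symm s, ?_⟩, rfl⟩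
      rw [Submodule.mem_comap, LinearEquiv.coe_coe, LinearEquiv.apply_symm_apply]
      exact s.2

end Minimal

theorem torsorOfPeriods_le [IsAlgClosed k] {T : PointFamily k N.dR N.B} (hT : IsSubtorsor T)
    (hc : N.c ∈ T ℂ) : torsorOfPeriods N ≤ T := by
  intro R _ _ f hf
  rw [mem_torsorOfPeriods_iff] at hf
  obtain ⟨t₀, ht₀⟩ := hT.1.exists_rational hc
  obtain ⟨I, hI⟩ := id hT.1
  rw [hI]
  intro φ hφ
  obtain ⟨l, v, m, h⟩ := exists_coeff_eq φ
  obtain ⟨c, hc'⟩ := (tensorSpace N l).exists_orbit_comparison (v := v) hT.1 hT.isHeap ht₀ hc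
  obtain ⟨g, hg⟩ := hf l ⟨_, _, c⟩ ⟨Submodule.subtype _, Submodule.subtype _, hc'⟩
    (Submodule.injective_subtype _) (Submodule.injective_subtype _)
  -- The image of `v` under `t₀` is itself a point of the orbit.
  have hv : v ∈ (orbitSpan T (tensorSpace N l) v).comap
      ((tensorSpace N l).rationalEquiv t₀).toLinearMap := by
    refine (Submodule.mem_dualCoannihilator _).mpr fun m hm => ?_
    have := hm k t₀ ht₀
    rwa [evalDual_lid] at this
  -- The coefficient `m (t v)` is the equation `φ` of `T`, so `m` kills the orbit and hence its
  -- span.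
  have hm : m ∘ₗ (orbitSpan T (tensorSpace N l) v).subtype = 0 := by
    ext s
    refine (Submodule.mem_dualCoannihilator _).mp s.2 m fun R _ _ t ht => ?_
    rw [← h]
    exact (hI R t).mp ht φ hφ
  have := hg.apply (1 ⊗ₜ ⟨v, hv⟩)
  rw [LinearMap.baseChange_tmul] at this
  rw [h]
  refine (congrArg (evalDual R m) this).trans ?_
  rw [evalDual_baseChange]
  exact (congrArg (fun m' => evalDual R m' _) hm).trans (evalDual_zero _)

theorem isSmallestSubtorsorContaining_torsorOfPeriods [IsAlgClosed k] (N : Obj k k) :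
    IsSmallestSubtorsorContaining N.c (torsorOfPeriods N) :=
  ⟨⟨isSubtorsor_torsorOfPeriods N, c_mem_torsorOfPeriods N⟩,
    fun _ hT => torsorOfPeriods_le hT.1 hT.2⟩

end Extension

instance : IsAlgClosed Qbar :=
  (algebraicClosure.isAlgClosure ℚ ℂ).isAlgClosed

end DRB

end

/-- For every `ℚ̄`-de Rham–Betti object `N`, evaluation at `N` identifies the Tannakian torsor of
periods of `N` with the smallest `ℚ̄`-subtorsor of `Iso(N_dR, N_B)` containing `c_N`. For every
de Rham–Betti object `M`, the smallest `ℚ̄`-subtorsor of `Iso(M_dR, M_B ⊗ ℚ̄)` containing `c_M` is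
the Tannakian torsor of periods of `M ⊗ ℚ̄`. -/
theorem propositionP :
    (∀ N : DRB.Obj DRB.Qbar DRB.Qbar,
      (∀ (R : Type) [CommRing R] [Algebra DRB.Qbar R],
        Function.Injective (fun t : DRB.TensorIso N R => t.eval)) ∧
      DRB.IsSmallestSubtorsorContaining N.c (DRB.torsorOfPeriods N)) ∧
    (∀ M : DRB.Obj DRB.Qbar ℚ,
      DRB.IsSmallestSubtorsorContaining (V := M.dR) (W := DRB.Qbar ⊗[ℚ] M.B)
        M.comparisonPoint (DRB.torsorOfPeriods M.extendBetti)) := by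
  exact ⟨fun N => ⟨fun R _ _ => DRB.Extension.eval_injective,
      DRB.Extension.isSmallestSubtorsorContaining_torsorOfPeriods N⟩,
    fun M => DRB.Extension.isSmallestSubtorsorContaining_torsorOfPeriods M.extendBetti⟩
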